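/- Let $M_0$ be the boundary of the unit square $[0,1]^2$. A \emph{square metric space} is a metric space $(X,d_X)$ with all distances at most $2$, together with an injective map $S_X\colon M_0\to X$ such that (sq$_1$) for $i\in\{0,1\}$ and $r,s\in[0,1]$, $d_X(S_X(i,r),S_X(i,s))=|s-r|$ and $d_X(S_X(r,i),S_X(s,i))=|s-r|$; (sq$_2$) $d_X(S_X(r,s),S_X(t,u))\ge |r-t|+|s-u|$ for all $(r,s),(t,u)\in M_0$. Let $\mathsf{SquaMS}$ be the category of square metric spaces, whose morphisms are the short (i.e. $1$-Lipschitz) maps $f$ with $f\circ S_X=S_Y$. Let $M=\{0,1,2\}^2\setminus\{(1,1)\}$, whose elements $(i,j)$ are the (column, row) positions of the eight outer cells of a $3\times3$ grid. For a square metric space $X$, let $\sim$ be the equivalence relation on $M\times X$ generated by gluing the copies of $X$ along the common sides of adjacent cells: for $r\in[0,1]$, $((i,j),S_X(r,1))\sim((i,j+1),S_X(r,0))$ if $(i,j),(i,j+1)\in M$, and $((i,j),S_X(1,r))\sim((i+1,j),S_X(0,r))$ if $(i,j),(i+1,j)\in M$. Let $M\otimes X=(M\times X)/{\sim}$, and write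 $m\otimes x$ for the class of $(m,x)$. The distance of $m\otimes x$ and $n\otimes y$ is the infimum of the scores of all finite paths from $(m,x)$ to $(n,y)$ in $M\times X$, where the score is the sum over consecutive points of the path of: $0$ if they are related by $\sim$; otherwise $\frac13d_X(x',y')$ for points $(m',x'),(m',y')$ of the same copy, and $2$ for points of different copies. The boundary map is $S_{M\otimes X}(p)=m\otimes S_X(q)$ for any $m\in M$, $q\in M_0$ with $m+q=3p$. With $(M\otimes f)(m\otimes x)=m\otimes f(x)$ this is an endofunctor $M\otimes-$ of $\mathsf{SquaMS}$. Let $C$ be the Cauchy completion functor on $\mathsf{SquaMS}$ (with $S_{C(X)}$ the composite of $S_X$ and the embedding $X\to C(X)$), and let $\delta_X\colon M\otimes C(X)\to C(M\otimes X)$ be the canonical morphism $m\otimes\lim_k x_k\mapsto\lim_k(m\otimes x_k)$. \textbf{Theorem.} The functor $M\otimes-$ on $\mathsf{SquaMS}$ has an initial algebra. If $(G,\eta\colon M\otimes G\to G)$ is an initial algebra, then $\eta$ and $\delta_G$ are isomorphisms, and, with $Q=C(G)$ and $$\gamma=\delta_G^{-1}\circ C(\eta^{-1})\colon Q=C(G)\to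 C(M\otimes G)\cong M\otimes C(G)=M\otimes Q,$$ $(Q,\gamma)$ is a final coalgebra of $M\otimes-$ on $\mathsf{SquaMS}$: for every coalgebra $(B,\beta\colon B\to M\otimes B)$ there is a unique morphism $h\colon B\to Q$ of $\mathsf{SquaMS}$ with $\gamma\circ h=(M\otimes h)\circ\beta$. -/

import Mathlib

open CategoryTheory UniformSpace

universe u

noncomputable section

/-! ## The boundary of the unit square -/

/-- The boundary `M₀` of the unit square `[0,1]²`. -/
def SquareBoundary : Type :=
  {p : ℝ × ℝ // p.1 ∈ Set.Icc (0 : ℝ) 1 ∧ p.2 ∈ Set.Icc (0 : ℝ) 1 ∧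
    ((p.1 = 0 ∨ p.1 = 1) ∨ (p.2 = 0 ∨ p.2 = 1))}

namespace SquareBoundary

/-- The point `(0, r)` of the left side. -/
def left (r : Set.Icc (0 : ℝ) 1) : SquareBoundary :=
  ⟨(0, r), by simp, r.2, by simp⟩

/-- The point `(1, r)` of the right side. -/
def right (r : Set.Icc (0 : ℝ) 1) : SquareBoundary :=
  ⟨(1, r), by simp, r.2, by simp⟩

/-- The point `(r, 0)` of the bottom side. -/
def bottom (r : Set.Icc (0 : ℝ) 1) : SquareBoundary :=
  ⟨(r, 0), r.2, by simp, by simp⟩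

/-- The point `(r, 1)` of the top side. -/
def top (r : Set.Icc (0 : ℝ) 1) : SquareBoundary :=
  ⟨(r, 1), r.2, by simp, by simp⟩

/-- First coordinate. -/
def fst (p : SquareBoundary) : ℝ := p.1.1

/-- Second coordinate. -/
def snd (p : SquareBoundary) : ℝ := p.1.2

theorem ext' {p q : SquareBoundary} (h1 : p.fst = q.fst) (h2 : p.snd = q.snd) : p = q :=
  Subtype.ext (Prod.ext h1 h2)

theorem fst_nonneg (p : SquareBoundary) : 0 ≤ p.fst := p.2.1.1
theorem fst_le (p : SquareBoundary) : p.fst ≤ 1 := p.2.1.2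
theorem snd_nonneg (p : SquareBoundary) : 0 ≤ p.snd := p.2.2.1.1
theorem snd_le (p : SquareBoundary) : p.snd ≤ 1 := p.2.2.1.2
theorem fst_mem (p : SquareBoundary) : p.fst ∈ Set.Icc (0 : ℝ) 1 := p.2.1
theorem snd_mem (p : SquareBoundary) : p.snd ∈ Set.Icc (0 : ℝ) 1 := p.2.2.1

theorem eq_left {p : SquareBoundary} (h : p.fst = 0) :
    p = left ⟨p.snd, p.snd_mem⟩ := ext' h rfl
theorem eq_right {p : SquareBoundary} (h : p.fst = 1) :
    p = right ⟨p.snd, p.snd_mem⟩ := ext' h rfl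
theorem eq_bottom {p : SquareBoundary} (h : p.snd = 0) :
    p = bottom ⟨p.fst, p.fst_mem⟩ := ext' rfl h
theorem eq_top {p : SquareBoundary} (h : p.snd = 1) :
    p = top ⟨p.fst, p.fst_mem⟩ := ext' rfl h

end SquareBoundary

/-! ## The category of square metric spaces -/

/-- A square metric space: a metric space bounded by `2` with an injective map `S` from the
boundary of the unit square such that, along each of the four sides, distances are those of the
unit interval (`sq₁`), and all distances between boundary points are at least the taxicab
distances (`sq₂`). -/
structure SquaMS : Type (u + 1) where
  carrier : Type u
  [metric : MetricSpace carrier]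
  dist_le_two : ∀ x y : carrier, dist x y ≤ 2
  S : SquareBoundary → carrier
  S_injective : Function.Injective S
  sq₁_left : ∀ r s : Set.Icc (0 : ℝ) 1, dist (S (.left r)) (S (.left s)) = |(s : ℝ) - r|
  sq₁_right : ∀ r s : Set.Icc (0 : ℝ) 1, dist (S (.right r)) (S (.right s)) = |(s : ℝ) - r|
  sq₁_bottom : ∀ r s : Set.Icc (0 : ℝ) 1, dist (S (.bottom r)) (S (.bottom s)) = |(s : ℝ) - r|
  sq₁_top : ∀ r s : Set.Icc (0 : ℝ) 1, dist (S (.top r)) (S (.top s)) = |(s : ℝ) - r|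
  sq₂ : ∀ p q : SquareBoundary, |p.fst - q.fst| + |p.snd - q.snd| ≤ dist (S p) (S q)

namespace SquaMS

instance : CoeSort SquaMS.{u} (Type u) := ⟨SquaMS.carrier⟩

instance (X : SquaMS.{u}) : MetricSpace X := X.metric

/-- Morphisms of square metric spaces: short maps that preserve `S`. -/
@[ext]
structure Hom (X Y : SquaMS.{u}) : Type u where
  toFun : X → Y
  short : ∀ x y : X, dist (toFun x) (toFun y) ≤ dist x y
  map_S : ∀ p : SquareBoundary, toFun (X.S p) = Y.S p

instance : Category SquaMS.{u} where
  Hom := Hom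
  id X := ⟨fun x => x, fun _ _ => le_rfl, fun _ => rfl⟩
  comp f g := ⟨fun x => g.toFun (f.toFun x),
    fun x y => (g.short _ _).trans (f.short x y),
    fun p => by rw [f.map_S, g.map_S]⟩

theorem Hom.lipschitz {X Y : SquaMS.{u}} (f : Hom X Y) : LipschitzWith 1 f.toFun :=
  LipschitzWith.of_dist_le_mul (by simpa using f.short)

/-! ## The Cauchy completion functor -/

/-- The Cauchy completion of a square metric space; `S` is composed with the canonical
embedding. -/
def completion (X : SquaMS.{u}) : SquaMS.{u} where
  carrier := Completion X
  dist_le_two x y := by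
    induction x, y using Completion.induction_on₂ with
    | hp => exact isClosed_le continuous_dist continuous_const
    | ih a b => rw [Completion.dist_eq]; exact X.dist_le_two a b
  S p := (X.S p : Completion X)
  S_injective := fun p q h => X.S_injective (Completion.coe_injective _ h)
  sq₁_left r s := by rw [Completion.dist_eq]; exact X.sq₁_left r s
  sq₁_right r s := by rw [Completion.dist_eq]; exact X.sq₁_right r s
  sq₁_bottom r s := by rw [Completion.dist_eq]; exact X.sq₁_bottom r s
  sq₁_top r s := by rw [Completion.dist_eq]; exact X.sq₁_top r s
  sq₂ p q := by rw [Completion.dist_eq]; exact X.sq₂ p q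

/-- The Cauchy completion functor `C` on square metric spaces. -/
def completionFunctor : SquaMS.{u} ⥤ SquaMS.{u} where
  obj X := X.completion
  map {X Y} f :=
    { toFun := Completion.map f.toFun
      short := by
        have h := (Hom.lipschitz f).completion_map
        intro x y
        exact (h.dist_le_mul x y).trans_eq (one_mul _)
      map_S := fun p => by
        change Completion.map f.toFun (X.S p : Completion X) = (Y.S p : Completion Y)
        rw [Completion.map_coe (Hom.lipschitz f).uniformContinuous, f.map_S] }
  map_id X := by
    apply Hom.ext
    exact Completion.map_id
  map_comp {X Y Z} f g := by
    apply Hom.ext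
    exact (Completion.map_comp (Hom.lipschitz g).uniformContinuous
      (Hom.lipschitz f).uniformContinuous).symm

/-! ## The underlying set of `M ⊗ X` -/

/-- The index set `M = {0,1,2}² \ {(1,1)}`; `(i, j)` is the (column, row) of a cell of the
`3 × 3` grid. -/
abbrev Idx : Type := {m : Fin 3 × Fin 3 // m ≠ (1, 1)}

/-- Column of an index as a real number. -/
def Idx.col (m : Idx) : ℝ := (m.1.1 : ℕ)

/-- Row of an index as a real number. -/
def Idx.row (m : Idx) : ℝ := (m.1.2 : ℕ)

/-- The eight families of generating identifications on `M × M₀`. -/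
inductive E : Idx × SquareBoundary → Idx × SquareBoundary → Prop
  | e1 (r) : E (⟨(0, 0), by decide⟩, .top r) (⟨(0, 1), by decide⟩, .bottom r)
  | e2 (r) : E (⟨(0, 1), by decide⟩, .top r) (⟨(0, 2), by decide⟩, .bottom r)
  | e3 (r) : E (⟨(0, 2), by decide⟩, .right r) (⟨(1, 2), by decide⟩, .left r)
  | e4 (r) : E (⟨(1, 2), by decide⟩, .right r) (⟨(2, 2), by decide⟩, .left r)
  | e5 (r) : E (⟨(2, 2), by decide⟩, .bottom r) (⟨(2, 1), by decide⟩, .top r)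
  | e6 (r) : E (⟨(2, 1), by decide⟩, .bottom r) (⟨(2, 0), by decide⟩, .top r)
  | e7 (r) : E (⟨(2, 0), by decide⟩, .left r) (⟨(1, 0), by decide⟩, .right r)
  | e8 (r) : E (⟨(1, 0), by decide⟩, .left r) (⟨(0, 0), by decide⟩, .right r)

variable (X Y : SquaMS.{u})

/-- The relation on `M × X` induced by `E`. -/
def Glue (a b : Idx × X) : Prop :=
  ∃ p q : SquareBoundary, E (a.1, p) (b.1, q) ∧ a.2 = X.S p ∧ b.2 = X.S q

/-- The equivalence relation on `M × X` generated by the identifications. -/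
def glueSetoid : Setoid (Idx × X) := Relation.EqvGen.setoid (Glue X)

/-- The metric on `M × X`: scaled by `1/3` in each copy of `X`, and `2` between different
copies. -/
def prodDist (a b : Idx × X) : ℝ := if a.1 = b.1 then dist a.2 b.2 / 3 else 2

open Classical in
/-- The contribution of a pair of consecutive points of a path to its score: identified
points count `0`. -/
def stepScore (a b : Idx × X) : ℝ := if glueSetoid X a b then 0 else prodDist X a b

/-- The score of the finite path from `a` to `b` through the given list of intermediate points
of `M × X`. -/
def score : Idx × X → List (Idx × X) → Idx × X → ℝ
  | a, [], b => stepScore X a b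
  | a, c :: l, b => stepScore X a c + score c l b

/-- The infimum of the scores of all finite paths from `a` to `b` in `M × X`. -/
def pathDist (a b : Idx × X) : ℝ := ⨅ l : List (Idx × X), score X a l b

/-- The underlying set of `M ⊗ X`. -/
def Tensor : Type u := Quotient (glueSetoid X)

variable {X Y}

/-- The class `m ⊗ x`. -/
def tmk (a : Idx × X) : Tensor X := Quotient.mk (glueSetoid X) a

/-! ### The path pseudometric -/

theorem prodDist_nonneg (a b : Idx × X) : 0 ≤ prodDist X a b := by
  unfold prodDist; split_ifs <;> positivity

theorem prodDist_le (a b : Idx × X) : prodDist X a b ≤ 2 := by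
  unfold prodDist; split_ifs
  · linarith [X.dist_le_two a.2 b.2]
  · exact le_rfl

theorem prodDist_comm (a b : Idx × X) : prodDist X a b = prodDist X b a := by
  unfold prodDist; rw [dist_comm]; simp only [eq_comm]

theorem stepScore_nonneg (a b : Idx × X) : 0 ≤ stepScore X a b := by
  unfold stepScore; split_ifs
  · exact le_rfl
  · exact prodDist_nonneg a b

theorem stepScore_le (a b : Idx × X) : stepScore X a b ≤ prodDist X a b := by
  unfold stepScore; split_ifs
  · exact prodDist_nonneg a b
  · exact le_rfl

theorem stepScore_comm (a b : Idx × X) : stepScore X a b = stepScore X b a := by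
  unfold stepScore
  rw [prodDist_comm, (glueSetoid X).comm']

theorem stepScore_eq_zero {a b : Idx × X} (h : glueSetoid X a b) : stepScore X a b = 0 := by
  unfold stepScore; rw [if_pos h]

theorem score_nonneg (a : Idx × X) (l : List (Idx × X)) (b : Idx × X) :
    0 ≤ score X a l b := by
  induction l generalizing a with
  | nil => exact stepScore_nonneg a b
  | cons c l ih => exact add_nonneg (stepScore_nonneg a c) (ih c)

theorem score_append (a : Idx × X) (l : List (Idx × X)) (b : Idx × X) (l' : List (Idx × X))
    (c : Idx × X) : score X a (l ++ b :: l') c = score X a l b + score X b l' c := by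
  induction l generalizing a with
  | nil => rfl
  | cons d l ih => simp only [List.cons_append, score, ih, add_assoc]

theorem score_reverse (a : Idx × X) (l : List (Idx × X)) (b : Idx × X) :
    score X b l.reverse a = score X a l b := by
  induction l generalizing a with
  | nil => exact stepScore_comm b a
  | cons c l ih =>
    rw [List.reverse_cons, score_append, ih c]
    simp only [score]
    rw [stepScore_comm c a, add_comm]

theorem bddBelow_score (a b : Idx × X) :
    BddBelow (Set.range fun l : List (Idx × X) => score X a l b) :=
  ⟨0, by rintro _ ⟨l, rfl⟩; exact score_nonneg a l b⟩

theorem pathDist_le_score (a : Idx × X) (l : List (Idx × X)) (b : Idx × X) :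
    pathDist X a b ≤ score X a l b := ciInf_le (bddBelow_score a b) l

theorem pathDist_le_step (a b : Idx × X) : pathDist X a b ≤ stepScore X a b :=
  pathDist_le_score a [] b

theorem pathDist_nonneg (a b : Idx × X) : 0 ≤ pathDist X a b :=
  le_ciInf fun l => score_nonneg a l b

theorem pathDist_comm (a b : Idx × X) : pathDist X a b = pathDist X b a := by
  apply le_antisymm <;> refine le_ciInf fun l => ?_
  · rw [← score_reverse]; exact pathDist_le_score _ _ _
  · rw [← score_reverse]; exact pathDist_le_score _ _ _

theorem pathDist_triangle (a b c : Idx × X) :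
    pathDist X a c ≤ pathDist X a b + pathDist X b c := by
  have h1 : ∀ l' : List (Idx × X), pathDist X a c - score X b l' c ≤ pathDist X a b := by
    intro l'
    refine le_ciInf fun l => ?_
    have := pathDist_le_score a (l ++ b :: l') c
    rw [score_append] at this
    linarith
  have h2 : pathDist X a c - pathDist X a b ≤ pathDist X b c :=
    le_ciInf fun l' => by linarith [h1 l']
  linarith

theorem pathDist_eq_zero {a b : Idx × X} (h : glueSetoid X a b) : pathDist X a b = 0 :=
  le_antisymm ((pathDist_le_step a b).trans (stepScore_eq_zero h).le) (pathDist_nonneg a b)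

theorem pathDist_congr {a b a' b' : Idx × X} (ha : glueSetoid X a a')
    (hb : glueSetoid X b b') : pathDist X a b = pathDist X a' b' := by
  have h1 := pathDist_triangle a a' b
  have h2 := pathDist_triangle a' b' b
  have h3 := pathDist_triangle a' a b'
  have h4 := pathDist_triangle a b b'
  rw [pathDist_eq_zero ha] at h1
  rw [pathDist_eq_zero ((glueSetoid X).symm' hb)] at h2
  rw [pathDist_eq_zero ((glueSetoid X).symm' ha)] at h3
  rw [pathDist_eq_zero hb] at h4
  linarith

/-- A map on `M × X` that respects the generating identifications respects the generated
equivalence relation. -/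
theorem respects {Z : Type*} (F : Idx × X → Z) (hF : ∀ a b, Glue X a b → F a = F b)
    {a b : Idx × X} (h : glueSetoid X a b) : F a = F b := by
  replace h : Relation.EqvGen (Glue X) a b := h
  induction h with
  | rel a b h => exact hF a b h
  | refl => rfl
  | symm a b h ih => exact ih.symm
  | trans a b c h1 h2 ih1 ih2 => exact ih1.trans ih2

/-- A map on `M × X` that respects the identifications and is short for the metric of `M × X` is
short for the path metric. -/
theorem short_of_prodDist {Z : Type*} [PseudoMetricSpace Z] (F : Idx × X → Z)
    (hF : ∀ a b, Glue X a b → F a = F b)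
    (hd : ∀ a b, dist (F a) (F b) ≤ prodDist X a b) (a b : Idx × X) :
    dist (F a) (F b) ≤ pathDist X a b := by
  have hs : ∀ a b, dist (F a) (F b) ≤ stepScore X a b := by
    intro a b
    unfold stepScore
    split_ifs with h
    · rw [respects F hF h, dist_self]
    · exact hd a b
  refine le_ciInf fun l => ?_
  induction l generalizing a with
  | nil => exact hs a b
  | cons c l ih => exact (dist_triangle _ (F c) _).trans (add_le_add (hs a c) (ih c))

/-! ### Boundary points and their positions in the `3 × 3` grid -/

theorem E_pos {a b : Idx × SquareBoundary} (h : E a b) :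
    a.1.col + a.2.fst = b.1.col + b.2.fst ∧ a.1.row + a.2.snd = b.1.row + b.2.snd := by
  cases h <;>
    simp [Idx.col, Idx.row, SquareBoundary.fst, SquareBoundary.snd, SquareBoundary.left,
      SquareBoundary.right, SquareBoundary.top, SquareBoundary.bottom] <;> norm_num

theorem glue_vert {m n : Idx} {p q : SquareBoundary} (hc : m.1.1 = n.1.1)
    (hr : (m.1.2 : ℕ) + 1 = n.1.2) (hp : p.snd = 1) (hq : q.snd = 0) (h : p.fst = q.fst) :
    glueSetoid X (m, X.S p) (n, X.S q) := by
  have hq' : q = .bottom ⟨p.fst, p.fst_mem⟩ := SquareBoundary.ext' h.symm hq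
  have cases : ∀ m n : Fin 3 × Fin 3, m ≠ (1, 1) → n ≠ (1, 1) → m.1 = n.1 →
      (m.2 : ℕ) + 1 = (n.2 : ℕ) →
      (m = (0, 0) ∧ n = (0, 1)) ∨
      (m = (0, 1) ∧ n = (0, 2)) ∨
      (m = (2, 1) ∧ n = (2, 2)) ∨
      (m = (2, 0) ∧ n = (2, 1)) := by decide
  have key : E (m, p) (n, q) ∨ E (n, q) (m, p) := by
    rw [hq', SquareBoundary.eq_top hp]
    obtain ⟨m, hm⟩ := m
    obtain ⟨n, hn⟩ := n
    rcases cases _ _ hm hn hc hr with ⟨e, e'⟩ | ⟨e, e'⟩ | ⟨e, e'⟩ | ⟨e, e'⟩ <;>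
      (subst e; subst e')
    · exact Or.inl (E.e1 _)
    · exact Or.inl (E.e2 _)
    · exact Or.inr (E.e5 _)
    · exact Or.inr (E.e6 _)
  rcases key with h | h
  · exact .rel _ _ ⟨p, q, h, rfl, rfl⟩
  · exact .symm _ _ (.rel _ _ ⟨q, p, h, rfl, rfl⟩)

theorem glue_horiz {m n : Idx} {p q : SquareBoundary} (hc : m.1.2 = n.1.2)
    (hr : (m.1.1 : ℕ) + 1 = n.1.1) (hp : p.fst = 1) (hq : q.fst = 0) (h : p.snd = q.snd) :
    glueSetoid X (m, X.S p) (n, X.S q) := by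
  have hq' : q = .left ⟨p.snd, p.snd_mem⟩ := SquareBoundary.ext' hq h.symm
  have cases : ∀ m n : Fin 3 × Fin 3, m ≠ (1, 1) → n ≠ (1, 1) → m.2 = n.2 →
      (m.1 : ℕ) + 1 = (n.1 : ℕ) →
      (m = (0, 2) ∧ n = (1, 2)) ∨
      (m = (1, 2) ∧ n = (2, 2)) ∨
      (m = (1, 0) ∧ n = (2, 0)) ∨
      (m = (0, 0) ∧ n = (1, 0)) := by decide
  have key : E (m, p) (n, q) ∨ E (n, q) (m, p) := by
    rw [hq', SquareBoundary.eq_right hp]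
    obtain ⟨m, hm⟩ := m
    obtain ⟨n, hn⟩ := n
    rcases cases _ _ hm hn hc hr with ⟨e, e'⟩ | ⟨e, e'⟩ | ⟨e, e'⟩ | ⟨e, e'⟩ <;>
      (subst e; subst e')
    · exact Or.inl (E.e3 _)
    · exact Or.inl (E.e4 _)
    · exact Or.inr (E.e7 _)
    · exact Or.inr (E.e8 _)
  rcases key with h | h
  · exact .rel _ _ ⟨p, q, h, rfl, rfl⟩
  · exact .symm _ _ (.rel _ _ ⟨q, p, h, rfl, rfl⟩)

/-- A coordinate comparison: two unit intervals `[i, i+1]`, `[k, k+1]` meeting in a point. -/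
theorem coord_cases {i k : Fin 3} {a b : ℝ} (ha0 : 0 ≤ a) (ha1 : a ≤ 1) (hb0 : 0 ≤ b)
    (hb1 : b ≤ 1) (h : ((i : ℕ) : ℝ) + a = ((k : ℕ) : ℝ) + b) :
    (i = k ∧ a = b) ∨ ((i : ℕ) + 1 = k ∧ a = 1 ∧ b = 0) ∨
      ((k : ℕ) + 1 = i ∧ b = 1 ∧ a = 0) := by
  rcases lt_trichotomy (i : ℕ) (k : ℕ) with hlt | heq | hlt
  · have h1 : ((i : ℕ) : ℝ) + 1 ≤ ((k : ℕ) : ℝ) := by exact_mod_cast hlt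
    refine Or.inr (Or.inl ⟨?_, by linarith, by linarith⟩)
    have h2 : ((k : ℕ) : ℝ) = ((i : ℕ) : ℝ) + 1 := by linarith
    have h3 : (k : ℕ) = (i : ℕ) + 1 := by exact_mod_cast h2
    exact h3.symm
  · refine Or.inl ⟨Fin.ext heq, ?_⟩
    rw [heq] at h; linarith
  · have h1 : ((k : ℕ) : ℝ) + 1 ≤ ((i : ℕ) : ℝ) := by exact_mod_cast hlt
    refine Or.inr (Or.inr ⟨?_, by linarith, by linarith⟩)
    have h2 : ((i : ℕ) : ℝ) = ((k : ℕ) : ℝ) + 1 := by linarith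
    have h3 : (i : ℕ) = (k : ℕ) + 1 := by exact_mod_cast h2
    exact h3.symm

/-- Two cells that meet in a corner only: their common corner is identified. -/
theorem glue_diag {m n : Idx} {p q : SquareBoundary}
    (h1 : (m.1.1 : ℕ) + 1 = n.1.1) (hp1 : p.fst = 1) (hq1 : q.fst = 0)
    (h2 : ((m.1.2 : ℕ) + 1 = n.1.2 ∧ p.snd = 1 ∧ q.snd = 0) ∨
      ((n.1.2 : ℕ) + 1 = m.1.2 ∧ q.snd = 1 ∧ p.snd = 0)) :
    glueSetoid X (m, X.S p) (n, X.S q) := by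
  -- one of the two cells adjacent to both is not the central one
  by_cases hc : (m.1.1, n.1.2) = ((1, 1) : Fin 3 × Fin 3)
  · have hc' : (n.1.1, m.1.2) ≠ ((1, 1) : Fin 3 × Fin 3) := by
      intro h
      have e1 := congrArg (fun t : Fin 3 × Fin 3 => (t.1 : ℕ)) hc
      have e2 := congrArg (fun t : Fin 3 × Fin 3 => (t.1 : ℕ)) h
      simp only at e1 e2
      omega
    let k : Idx := ⟨(n.1.1, m.1.2), hc'⟩
    let s : SquareBoundary := .left ⟨p.snd, p.snd_mem⟩
    refine (glueSetoid X).trans' (y := (k, X.S s)) (glue_horiz rfl h1 hp1 rfl rfl) ?_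
    rcases h2 with ⟨ha, hb, hd⟩ | ⟨ha, hb, hd⟩
    · exact glue_vert rfl ha hb hd hq1.symm
    · exact (glueSetoid X).symm' (glue_vert rfl ha hb hd hq1)
  · let k : Idx := ⟨(m.1.1, n.1.2), hc⟩
    let s : SquareBoundary := .right ⟨q.snd, q.snd_mem⟩
    refine (glueSetoid X).trans' (y := (k, X.S s)) ?_ (glue_horiz rfl h1 rfl hq1 rfl)
    rcases h2 with ⟨ha, hb, hd⟩ | ⟨ha, hb, hd⟩
    · exact glue_vert rfl ha hb hd hp1
    · exact (glueSetoid X).symm' (glue_vert rfl ha hb hd hp1.symm)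

/-- Boundary points with the same position in the grid are identified. -/
theorem glue_of_pos {m n : Idx} {p q : SquareBoundary}
    (h1 : m.col + p.fst = n.col + q.fst) (h2 : m.row + p.snd = n.row + q.snd) :
    glueSetoid X (m, X.S p) (n, X.S q) := by
  have c1 := coord_cases p.fst_nonneg p.fst_le q.fst_nonneg q.fst_le h1
  have c2 := coord_cases p.snd_nonneg p.snd_le q.snd_nonneg q.snd_le h2
  rcases c1 with ⟨a1, b1⟩ | ⟨a1, b1, d1⟩ | ⟨a1, b1, d1⟩
  · rcases c2 with ⟨a2, b2⟩ | ⟨a2, b2, d2⟩ | ⟨a2, b2, d2⟩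
    · have e1 : m = n := Subtype.ext (Prod.ext a1 a2)
      have e2 : p = q := SquareBoundary.ext' b1 b2
      rw [e1, e2]
    · exact glue_vert a1 a2 b2 d2 b1
    · exact (glueSetoid X).symm' (glue_vert a1.symm a2 b2 d2 b1.symm)
  · rcases c2 with ⟨a2, b2⟩ | c2 | c2
    · exact glue_horiz a2 a1 b1 d1 b2
    · exact glue_diag a1 b1 d1 (Or.inl c2)
    · exact glue_diag a1 b1 d1 (Or.inr c2)
  · rcases c2 with ⟨a2, b2⟩ | c2 | c2
    · exact (glueSetoid X).symm' (glue_horiz a2.symm a1 b1 d1 b2.symm)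
    · exact (glueSetoid X).symm' (glue_diag a1 b1 d1 (Or.inr c2))
    · exact (glueSetoid X).symm' (glue_diag a1 b1 d1 (Or.inl c2))

/-! ### Lower bounds for the path metric -/

theorem exists_extension (φ : SquareBoundary → ℝ) (lo : ℝ)
    (hφ : ∀ p q, |φ p - φ q| ≤ |p.fst - q.fst| + |p.snd - q.snd|)
    (hlo : ∀ p, lo ≤ φ p ∧ φ p ≤ lo + 2) :
    ∃ g : X → ℝ, (∀ x y, |g x - g y| ≤ dist x y) ∧ (∀ x, lo ≤ g x ∧ g x ≤ lo + 2) ∧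
      ∀ p, g (X.S p) = φ p := by
  let f : X → ℝ := Function.extend X.S φ 0
  have hf : ∀ p, f (X.S p) = φ p := fun p => X.S_injective.extend_apply φ 0 p
  have hl : LipschitzOnWith 1 f (Set.range X.S) := by
    refine LipschitzOnWith.of_dist_le_mul ?_
    rintro _ ⟨p, rfl⟩ _ ⟨q, rfl⟩
    rw [hf, hf, Real.dist_eq, NNReal.coe_one, one_mul]
    exact (hφ p q).trans (X.sq₂ p q)
  obtain ⟨g, hg, hfg⟩ := hl.extend_real
  refine ⟨fun x => max lo (min (g x) (lo + 2)), ?_, ?_, ?_⟩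
  · intro x y
    have h1 : |g x - g y| ≤ dist x y := by
      have := hg.dist_le_mul x y
      simpa [Real.dist_eq] using this
    refine (abs_max_sub_max_le_max _ _ _ _).trans ?_
    rw [sub_self, abs_zero]
    refine max_le dist_nonneg ((abs_min_sub_min_le_max _ _ _ _).trans ?_)
    rw [sub_self, abs_zero]
    exact max_le h1 dist_nonneg
  · intro x
    exact ⟨le_max_left _ _, max_le (by linarith) (min_le_right _ _)⟩
  · intro p
    have h1 : g (X.S p) = φ p := by rw [← hf p, hfg ⟨p, rfl⟩]
    obtain ⟨h2, h3⟩ := hlo p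
    simp only [h1, min_eq_left h3, max_eq_right h2]

theorem Idx.bounds (m : Idx) : 0 ≤ m.col ∧ m.col ≤ 2 ∧ 0 ≤ m.row ∧ m.row ≤ 2 := by
  have h1 : (m.1.1 : ℕ) ≤ 2 := by omega
  have h2 : (m.1.2 : ℕ) ≤ 2 := by omega
  refine ⟨Nat.cast_nonneg _, ?_, Nat.cast_nonneg _, ?_⟩
  · unfold Idx.col; exact_mod_cast h1
  · unfold Idx.row; exact_mod_cast h2

theorem pathDist_lower (a b : Idx → ℝ) (φ : SquareBoundary → ℝ) (lo : ℝ)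
    (hφ : ∀ p q, |φ p - φ q| ≤ |p.fst - q.fst| + |p.snd - q.snd|)
    (hlo : ∀ p, lo ≤ φ p ∧ φ p ≤ lo + 2)
    (ha : ∀ m, b m = a m + 2 * lo ∧ 0 ≤ a m ∧ a m ≤ 4)
    (hE : ∀ m n p q, E (m, p) (n, q) → b m + φ p = b n + φ q)
    (m n : Idx) (p q : SquareBoundary) :
    |(b m + φ p) / 3 - (b n + φ q) / 3| ≤ pathDist X (m, X.S p) (n, X.S q) := by
  obtain ⟨g, hg, hb, hS⟩ := exists_extension (X := X) φ lo hφ hlo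
  have := short_of_prodDist (X := X) (fun c => (b c.1 + g c.2) / 3) ?_ ?_ (m, X.S p) (n, X.S q)
  · simpa only [Real.dist_eq, hS] using this
  · rintro ⟨m, x⟩ ⟨n, y⟩ ⟨p, q, h, hx, hy⟩
    simp only at hx hy h ⊢
    rw [hx, hy, hS, hS, hE _ _ _ _ h]
  · rintro ⟨m, x⟩ ⟨n, y⟩
    unfold prodDist
    simp only [Real.dist_eq]
    split_ifs with h
    · subst h
      rw [← sub_div, abs_div, abs_of_pos (by norm_num : (0 : ℝ) < 3), add_sub_add_left_eq_sub]
      linarith [hg x y]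
    · have h1 := ha m
      have h2 := ha n
      have h3 := hb x
      have h4 := hb y
      rw [abs_le]
      constructor <;> linarith [h1.1, h1.2.1, h1.2.2, h2.1, h2.2.1, h2.2.2, h3.1, h3.2, h4.1, h4.2]

/-- The path metric dominates the taxicab distance of the positions of boundary points. -/
theorem taxi_le_pathDist (m n : Idx) (p q : SquareBoundary) :
    |(m.col + p.fst) / 3 - (n.col + q.fst) / 3| + |(m.row + p.snd) / 3 - (n.row + q.snd) / 3| ≤
      pathDist X (m, X.S p) (n, X.S q) := by
  have hu := pathDist_lower (X := X) (fun m => m.col + m.row) (fun m => m.col + m.row)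
    (fun p => p.fst + p.snd) 0 ?_ ?_ ?_ ?_ m n p q
  · have hv := pathDist_lower (X := X) (fun m => m.col - m.row + 2) (fun m => m.col - m.row)
      (fun p => p.fst - p.snd) (-1) ?_ ?_ ?_ ?_ m n p q
    · rw [abs_le] at hu hv
      rcases abs_cases ((m.col + p.fst) / 3 - (n.col + q.fst) / 3) with h1 | h1 <;>
      rcases abs_cases ((m.row + p.snd) / 3 - (n.row + q.snd) / 3) with h2 | h2 <;>
      · rw [h1.1, h2.1]; linarith [hu.1, hu.2, hv.1, hv.2]
    · intro p q
      calc _ = |(p.fst - q.fst) - (p.snd - q.snd)| := by ring_nf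
        _ ≤ _ := abs_sub _ _
    · intro p
      have := p.fst_nonneg; have := p.fst_le; have := p.snd_nonneg; have := p.snd_le
      constructor <;> linarith
    · intro m
      obtain ⟨h1, h2, h3, h4⟩ := m.bounds
      refine ⟨by ring, by linarith, by linarith⟩
    · intro m n p q h
      obtain ⟨h1, h2⟩ := E_pos h
      simp only at h1 h2
      linarith
  · intro p q
    calc _ = |(p.fst - q.fst) + (p.snd - q.snd)| := by ring_nf
      _ ≤ _ := abs_add_le _ _
  · intro p
    have := p.fst_nonneg; have := p.fst_le; have := p.snd_nonneg; have := p.snd_le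
    constructor <;> linarith
  · intro m
    obtain ⟨h1, h2, h3, h4⟩ := m.bounds
    refine ⟨by ring, by linarith, by linarith⟩
  · intro m n p q h
    obtain ⟨h1, h2⟩ := E_pos h
    simp only at h1 h2
    linarith

theorem isClosed_range_S : IsClosed (Set.range X.S) := by
  have h : Set.range X.S = (Set.range fun r => X.S (.left r)) ∪ (Set.range fun r => X.S (.right r)) ∪
      ((Set.range fun r => X.S (.bottom r)) ∪ (Set.range fun r => X.S (.top r))) := by
    ext x
    constructor
    · rintro ⟨p, rfl⟩
      rcases p.2.2.2 with (h | h) | (h | h)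
      · exact Or.inl (Or.inl ⟨_, congrArg X.S (SquareBoundary.eq_left h).symm⟩)
      · exact Or.inl (Or.inr ⟨_, congrArg X.S (SquareBoundary.eq_right h).symm⟩)
      · exact Or.inr (Or.inl ⟨_, congrArg X.S (SquareBoundary.eq_bottom h).symm⟩)
      · exact Or.inr (Or.inr ⟨_, congrArg X.S (SquareBoundary.eq_top h).symm⟩)
    · rintro ((⟨r, rfl⟩ | ⟨r, rfl⟩) | (⟨r, rfl⟩ | ⟨r, rfl⟩)) <;> exact ⟨_, rfl⟩
  have hc : ∀ f : Set.Icc (0 : ℝ) 1 → X, (∀ r s, dist (f r) (f s) = |(s : ℝ) - r|) →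
      IsClosed (Set.range f) := by
    intro f hf
    have hi : Isometry f := Isometry.of_dist_eq fun r s => by
      rw [hf, Subtype.dist_eq, Real.dist_eq, abs_sub_comm]
    exact (isCompact_range hi.continuous).isClosed
  rw [h]
  exact ((hc _ X.sq₁_left).union (hc _ X.sq₁_right)).union
    ((hc _ X.sq₁_bottom).union (hc _ X.sq₁_top))

theorem eq_of_pathDist_of_interior {m n : Idx} {x y : X} (hx : x ∉ Set.range X.S)
    (h : pathDist X (m, x) (n, y) = 0) : m = n ∧ x = y := by
  classical
  have hne : (Set.range X.S).Nonempty :=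
    ⟨X.S (.left ⟨0, by simp⟩), Set.mem_range_self _⟩
  set δ := Metric.infDist x (Set.range X.S) with hδ
  have hpos : 0 < δ := (isClosed_range_S.notMem_iff_infDist_pos hne).1 hx
  have hδ2 : δ ≤ 2 := by
    obtain ⟨z, hz⟩ := hne
    exact (Metric.infDist_le_dist_of_mem hz).trans (X.dist_le_two x z)
  let F : Idx × X → ℝ := fun c => if c.1 = m then min δ (dist x c.2) / 3 else δ / 3
  have hFS : ∀ k p, F (k, X.S p) = δ / 3 := by
    intro k p
    change (if k = m then min δ (dist x (X.S p)) / 3 else δ / 3) = _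
    split_ifs
    · rw [min_eq_left (Metric.infDist_le_dist_of_mem (Set.mem_range_self p))]
    · rfl
  have hF0 : ∀ c, 0 ≤ F c ∧ F c ≤ δ / 3 := by
    intro c
    change 0 ≤ (if c.1 = m then min δ (dist x c.2) / 3 else δ / 3) ∧
      (if c.1 = m then min δ (dist x c.2) / 3 else δ / 3) ≤ δ / 3
    split_ifs
    · have h1 : 0 ≤ min δ (dist x c.2) := le_min hpos.le dist_nonneg
      have h2 := min_le_left δ (dist x c.2)
      constructor <;> linarith
    · exact ⟨by linarith, le_rfl⟩
  have key := short_of_prodDist (X := X) F ?_ ?_ (m, x) (n, y)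
  · rw [h] at key
    have h0 : F (m, x) = F (n, y) := dist_le_zero.1 key
    have h1 : F (m, x) = 0 := by
      change (if m = m then min δ (dist x x) / 3 else δ / 3) = 0
      rw [if_pos rfl, dist_self, min_eq_right hpos.le, zero_div]
    have h2 : (if n = m then min δ (dist x y) / 3 else δ / 3) = 0 := h0.symm.trans h1
    split_ifs at h2 with hnm
    · refine ⟨hnm.symm, ?_⟩
      rcases min_choice δ (dist x y) with h3 | h3
      · rw [h3] at h2; linarith
      · rw [h3] at h2; exact dist_eq_zero.1 (by linarith)
    · linarith
  · rintro ⟨k, z⟩ ⟨l, w⟩ ⟨p, q, -, hz, hw⟩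
    simp only at hz hw
    rw [hz, hw, hFS, hFS]
  · rintro ⟨k, z⟩ ⟨l, w⟩
    unfold prodDist
    simp only [Real.dist_eq]
    split_ifs with hkl
    · subst hkl
      change |(if k = m then min δ (dist x z) / 3 else δ / 3) -
        (if k = m then min δ (dist x w) / 3 else δ / 3)| ≤ _
      split_ifs
      · rw [← sub_div, abs_div, abs_of_pos (by norm_num : (0 : ℝ) < 3)]
        have h1 := abs_min_sub_min_le_max δ (dist x z) δ (dist x w)
        rw [sub_self, abs_zero] at h1
        have h2 : |dist x z - dist x w| ≤ dist z w := by
          rw [dist_comm x z, dist_comm x w]; exact abs_dist_sub_le z w x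
        have h3 := h1.trans (max_le dist_nonneg h2)
        linarith
      · rw [sub_self, abs_zero]; positivity
    · have h1 := hF0 (k, z)
      have h2 := hF0 (l, w)
      rw [abs_le]
      constructor <;> linarith [h1.1, h1.2, h2.1, h2.2]

theorem glue_of_pathDist {a b : Idx × X} (h : pathDist X a b = 0) : glueSetoid X a b := by
  obtain ⟨m, x⟩ := a
  obtain ⟨n, y⟩ := b
  by_cases hx : x ∈ Set.range X.S
  · by_cases hy : y ∈ Set.range X.S
    · obtain ⟨p, rfl⟩ := hx
      obtain ⟨q, rfl⟩ := hy
      have h1 := taxi_le_pathDist (X := X) m n p q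
      rw [h] at h1
      have h2 := abs_nonneg ((m.col + p.fst) / 3 - (n.col + q.fst) / 3)
      have h3 := abs_nonneg ((m.row + p.snd) / 3 - (n.row + q.snd) / 3)
      have h4 := abs_eq_zero.1 (le_antisymm (by linarith) h2)
      have h5 := abs_eq_zero.1 (le_antisymm (by linarith) h3)
      exact glue_of_pos (by linarith) (by linarith)
    · rw [pathDist_comm] at h
      obtain ⟨rfl, rfl⟩ := eq_of_pathDist_of_interior hy h
      exact (glueSetoid X).refl' _
  · obtain ⟨rfl, rfl⟩ := eq_of_pathDist_of_interior hx h
    exact (glueSetoid X).refl' _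

/-! ### `M ⊗ X` as a square metric space -/

/-- The quotient metric on `M ⊗ X`. -/
instance : MetricSpace (Tensor X) where
  dist s t := Quotient.lift₂ (pathDist X) (fun _ _ _ _ ha hb => pathDist_congr ha hb) s t
  dist_self := by rintro ⟨a⟩; exact pathDist_eq_zero ((glueSetoid X).refl' a)
  dist_comm := by rintro ⟨a⟩ ⟨b⟩; exact pathDist_comm a b
  dist_triangle := by rintro ⟨a⟩ ⟨b⟩ ⟨c⟩; exact pathDist_triangle a b c
  eq_of_dist_eq_zero := by
    rintro ⟨a⟩ ⟨b⟩ h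
    exact Quotient.sound (glue_of_pathDist h)

theorem dist_tmk (a b : Idx × X) : dist (tmk a) (tmk b) = pathDist X a b := rfl

theorem tmk_eq {a b : Idx × X} (h : glueSetoid X a b) : tmk a = tmk b := Quotient.sound h

theorem dist_tmk_le (a b : Idx × X) : dist (tmk a) (tmk b) ≤ prodDist X a b :=
  (pathDist_le_step a b).trans (stepScore_le a b)

theorem dist_tmk_same (m : Idx) (x y : X) : dist (tmk (m, x)) (tmk (m, y)) ≤ dist x y / 3 := by
  refine (dist_tmk_le _ _).trans (le_of_eq ?_)
  unfold prodDist; rw [if_pos rfl]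

/-- Index of the third of the unit interval that contains `r`. -/
def third (r : ℝ) : Fin 3 := if r ≤ 1 / 3 then 0 else if r ≤ 2 / 3 then 1 else 2

theorem third_spec {r : ℝ} (h0 : 0 ≤ r) (h1 : r ≤ 1) :
    0 ≤ 3 * r - (third r : ℕ) ∧ 3 * r - (third r : ℕ) ≤ 1 := by
  unfold third; split_ifs <;> norm_num <;> constructor <;> linarith

theorem third_zero : third 0 = 0 := by unfold third; norm_num
theorem third_one : third 1 = 2 := by unfold third; norm_num

/-- The cell of the `3 × 3` grid that contains a boundary point. -/
def cell (p : SquareBoundary) : Idx :=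
  ⟨(third p.fst, third p.snd), by
    intro h
    have e1 : third p.fst = 1 := congrArg Prod.fst h
    have e2 : third p.snd = 1 := congrArg Prod.snd h
    rcases p.2.2.2 with (h | h) | (h | h)
    · rw [show p.fst = 0 from h, third_zero] at e1; exact absurd e1 (by decide)
    · rw [show p.fst = 1 from h, third_one] at e1; exact absurd e1 (by decide)
    · rw [show p.snd = 0 from h, third_zero] at e2; exact absurd e2 (by decide)
    · rw [show p.snd = 1 from h, third_one] at e2; exact absurd e2 (by decide)⟩

/-- The position of a boundary point relative to its cell, rescaled by `3`. -/
def rel (p : SquareBoundary) : SquareBoundary :=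
  ⟨(3 * p.fst - (third p.fst : ℕ), 3 * p.snd - (third p.snd : ℕ)),
    third_spec p.fst_nonneg p.fst_le, third_spec p.snd_nonneg p.snd_le, by
    rcases p.2.2.2 with (h | h) | (h | h)
    · rw [show p.fst = 0 from h, third_zero]; simp
    · rw [show p.fst = 1 from h, third_one]; norm_num
    · rw [show p.snd = 0 from h, third_zero]; simp
    · rw [show p.snd = 1 from h, third_one]; norm_num⟩

theorem cell_rel (p : SquareBoundary) :
    (cell p).col + (rel p).fst = 3 * p.fst ∧ (cell p).row + (rel p).snd = 3 * p.snd := by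
  constructor
  · change ((third p.fst : ℕ) : ℝ) + (3 * p.fst - (third p.fst : ℕ)) = _
    ring
  · change ((third p.snd : ℕ) : ℝ) + (3 * p.snd - (third p.snd : ℕ)) = _
    ring

variable (X) in
/-- The boundary map of `M ⊗ X`: each side of `M ⊗ X` consists of three scaled copies of the
corresponding side of `X`. -/
def tensorS (p : SquareBoundary) : Tensor X := tmk (cell p, X.S (rel p))

/-- `tensorS p = m ⊗ S q` whenever `q` in the cell `m` has the position of `p`; so the choice of
the cell for the points `1/3` and `2/3` of a side is immaterial. -/
theorem tensorS_eq {p q : SquareBoundary} {m : Idx} (h1 : m.col + q.fst = 3 * p.fst)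
    (h2 : m.row + q.snd = 3 * p.snd) : tensorS X p = tmk (m, X.S q) :=
  tmk_eq (glue_of_pos (by rw [h1, (cell_rel p).1]) (by rw [h2, (cell_rel p).2]))

theorem tensorS_lower (p q : SquareBoundary) :
    |p.fst - q.fst| + |p.snd - q.snd| ≤ dist (tensorS X p) (tensorS X q) := by
  have h := taxi_le_pathDist (X := X) (cell p) (cell q) (rel p) (rel q)
  rw [(cell_rel p).1, (cell_rel p).2, (cell_rel q).1, (cell_rel q).2] at h
  rw [tensorS, tensorS, dist_tmk]
  convert h using 3 <;> ring

/-- A map on the unit interval that is short on each third is short. -/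
theorem short_of_thirds {Z : Type*} [PseudoMetricSpace Z] (f : Set.Icc (0 : ℝ) 1 → Z)
    (h : ∀ i : Fin 3, ∀ r s : Set.Icc (0 : ℝ) 1, ((i : ℕ) : ℝ) ≤ 3 * (r : ℝ) →
      3 * (r : ℝ) ≤ (i : ℕ) + 1 → ((i : ℕ) : ℝ) ≤ 3 * (s : ℝ) → 3 * (s : ℝ) ≤ (i : ℕ) + 1 →
      dist (f r) (f s) ≤ |(s : ℝ) - r|) (r s : Set.Icc (0 : ℝ) 1) :
    dist (f r) (f s) ≤ |(s : ℝ) - r| := by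
  wlog hrs : r ≤ s generalizing r s
  · rw [dist_comm, abs_sub_comm]; exact this s r (le_of_not_ge hrs)
  have hrs' : (r : ℝ) ≤ s := hrs
  have c0 : (((0 : Fin 3) : ℕ) : ℝ) = 0 := Nat.cast_zero
  have c1 : (((1 : Fin 3) : ℕ) : ℝ) = 1 := Nat.cast_one
  have c2 : (((2 : Fin 3) : ℕ) : ℝ) = 2 := Nat.cast_ofNat
  have h0 := h 0
  have h1 := h 1
  have h2 := h 2
  rw [c0] at h0
  rw [c1] at h1
  rw [c2] at h2
  let a : Set.Icc (0 : ℝ) 1 := ⟨1 / 3, by norm_num, by norm_num⟩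
  let b : Set.Icc (0 : ℝ) 1 := ⟨2 / 3, by norm_num, by norm_num⟩
  have ha : (a : ℝ) = 1 / 3 := rfl
  have hb : (b : ℝ) = 2 / 3 := rfl
  have step : ∀ (c : Set.Icc (0 : ℝ) 1), (r : ℝ) ≤ c → (c : ℝ) ≤ s →
      dist (f r) (f c) ≤ |(c : ℝ) - r| → dist (f c) (f s) ≤ |(s : ℝ) - c| →
      dist (f r) (f s) ≤ |(s : ℝ) - r| := by
    intro c hc1 hc2 hd1 hd2
    rw [abs_of_nonneg (by linarith)] at hd1 hd2 ⊢
    linarith [dist_triangle (f r) (f c) (f s)]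
  have r0 := r.2.1
  have s1 := s.2.2
  -- first the pairs in the last two thirds
  have main : ∀ r s : Set.Icc (0 : ℝ) 1, (r : ℝ) ≤ s → 1 ≤ 3 * (r : ℝ) →
      dist (f r) (f s) ≤ |(s : ℝ) - r| := by
    intro r s hrs hr
    have s1 := s.2.2
    by_cases hs : 3 * (s : ℝ) ≤ 2
    · exact h1 r s hr (by linarith) (by linarith) (by linarith)
    · by_cases hr2 : 2 ≤ 3 * (r : ℝ)
      · exact h2 r s hr2 (by linarith) (by linarith) (by linarith)
      · have e1 := h1 r b hr (by linarith) (by rw [hb]; norm_num)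
          (by rw [hb]; norm_num)
        have e2 := h2 b s (by rw [hb]; norm_num) (by rw [hb]; norm_num)
          (by linarith) (by linarith)
        rw [abs_of_nonneg (by rw [hb]; linarith)] at e1 e2
        rw [abs_of_nonneg (by linarith)]
        linarith [dist_triangle (f r) (f b) (f s)]
  by_cases hr : 1 ≤ 3 * (r : ℝ)
  · exact main r s hrs' hr
  · by_cases hs : 3 * (s : ℝ) ≤ 1
    · exact h0 r s (by linarith) (by linarith) (by linarith) (by linarith)
    · refine step a (by rw [ha]; linarith) (by rw [ha]; linarith) ?_
        (main a s (by rw [ha]; linarith) (by rw [ha]; norm_num))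
      exact h0 r a (by linarith) (by linarith) (by rw [ha]; norm_num) (by rw [ha]; norm_num)

theorem tensorS_side_le (side : Set.Icc (0 : ℝ) 1 → SquareBoundary)
    (hside : ∀ r s, dist (X.S (side r)) (X.S (side s)) = |(s : ℝ) - r|) (idx : Fin 3 → Idx)
    (h : ∀ i : Fin 3, ∀ r t : Set.Icc (0 : ℝ) 1, ((i : ℕ) : ℝ) + t = 3 * r →
      (idx i).col + (side t).fst = 3 * (side r).fst ∧
      (idx i).row + (side t).snd = 3 * (side r).snd)
    (r s : Set.Icc (0 : ℝ) 1) :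
    dist (tensorS X (side r)) (tensorS X (side s)) ≤ |(s : ℝ) - r| := by
  refine short_of_thirds (fun r => tensorS X (side r)) ?_ r s
  intro i r s hr1 hr2 hs1 hs2
  let r' : Set.Icc (0 : ℝ) 1 := ⟨3 * r - (i : ℕ), by linarith, by linarith⟩
  let s' : Set.Icc (0 : ℝ) 1 := ⟨3 * s - (i : ℕ), by linarith, by linarith⟩
  have hr := h i r r' (add_sub_cancel _ _)
  have hs := h i s s' (add_sub_cancel _ _)
  change dist (tensorS X (side r)) (tensorS X (side s)) ≤ _
  rw [tensorS_eq hr.1 hr.2, tensorS_eq hs.1 hs.2]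
  refine (dist_tmk_same _ _ _).trans (le_of_eq ?_)
  rw [hside]
  have e : (s' : ℝ) - r' = 3 * ((s : ℝ) - r) := by
    change 3 * (s : ℝ) - (i : ℕ) - (3 * (r : ℝ) - (i : ℕ)) = _
    ring
  rw [e, abs_mul, abs_of_pos (by norm_num : (0 : ℝ) < 3)]
  ring

variable (X) in
/-- The square metric space `M ⊗ X`. -/
def tensor : SquaMS.{u} where
  carrier := Tensor X
  dist_le_two := by
    rintro ⟨a⟩ ⟨b⟩
    exact (dist_tmk_le a b).trans (prodDist_le a b)
  S := tensorS X
  S_injective := by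
    intro p q h
    have h1 := tensorS_lower (X := X) p q
    rw [h, dist_self] at h1
    have h2 := abs_nonneg (p.fst - q.fst)
    have h3 := abs_nonneg (p.snd - q.snd)
    have h4 := abs_eq_zero.1 (le_antisymm (by linarith) h2)
    have h5 := abs_eq_zero.1 (le_antisymm (by linarith) h3)
    exact SquareBoundary.ext' (sub_eq_zero.1 h4) (sub_eq_zero.1 h5)
  sq₁_left r s := by
    refine le_antisymm (tensorS_side_le _ X.sq₁_left
      (fun i => ⟨(0, i), by simp⟩) ?_ r s) ?_
    · intro i r t h
      simpa [Idx.col, Idx.row, SquareBoundary.left, SquareBoundary.fst, SquareBoundary.snd] using h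
    · have := tensorS_lower (X := X) (.left r) (.left s)
      simpa [SquareBoundary.left, SquareBoundary.fst, SquareBoundary.snd,
        abs_sub_comm (r : ℝ) s] using this
  sq₁_right r s := by
    refine le_antisymm (tensorS_side_le _ X.sq₁_right
      (fun i => ⟨(2, i), by simp⟩) ?_ r s) ?_
    · intro i r t h
      refine ⟨?_, h⟩
      change ((2 : ℕ) : ℝ) + 1 = 3 * 1
      norm_num
    · have := tensorS_lower (X := X) (.right r) (.right s)
      simpa [SquareBoundary.right, SquareBoundary.fst, SquareBoundary.snd,
        abs_sub_comm (r : ℝ) s] using this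
  sq₁_bottom r s := by
    refine le_antisymm (tensorS_side_le _ X.sq₁_bottom
      (fun i => ⟨(i, 0), by simp⟩) ?_ r s) ?_
    · intro i r t h
      simpa [Idx.col, Idx.row, SquareBoundary.bottom, SquareBoundary.fst,
        SquareBoundary.snd] using h
    · have := tensorS_lower (X := X) (.bottom r) (.bottom s)
      simpa [SquareBoundary.bottom, SquareBoundary.fst, SquareBoundary.snd,
        abs_sub_comm (r : ℝ) s] using this
  sq₁_top r s := by
    refine le_antisymm (tensorS_side_le _ X.sq₁_top
      (fun i => ⟨(i, 2), by simp⟩) ?_ r s) ?_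
    · intro i r t h
      refine ⟨h, ?_⟩
      change ((2 : ℕ) : ℝ) + 1 = 3 * 1
      norm_num
    · have := tensorS_lower (X := X) (.top r) (.top s)
      simpa [SquareBoundary.top, SquareBoundary.fst, SquareBoundary.snd,
        abs_sub_comm (r : ℝ) s] using this
  sq₂ p q := tensorS_lower p q

/-- The morphism `M ⊗ X ⟶ Z` induced by a map on `M × X` that respects the identifications and
the boundary and is short for the metric of `M × X`. -/
def tensorDesc {Z : SquaMS.{u}} (F : Idx × X → Z)
    (hF : ∀ a b, Glue X a b → F a = F b)
    (hd : ∀ a b, dist (F a) (F b) ≤ prodDist X a b)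
    (hS : ∀ p, F (cell p, X.S (rel p)) = Z.S p) : X.tensor ⟶ Z where
  toFun := Quotient.lift F fun _ _ h => respects F hF h
  short := by rintro ⟨a⟩ ⟨b⟩; exact short_of_prodDist F hF hd a b
  map_S p := hS p

/-- The functor `M ⊗ -` on square metric spaces; on morphisms, `m ⊗ x ↦ m ⊗ f x`. -/
def tensorFunctor : SquaMS.{u} ⥤ SquaMS.{u} where
  obj X := X.tensor
  map {X Y} f := tensorDesc (Z := Y.tensor) (fun a => tmk (a.1, f.toFun a.2))
    (by
      rintro ⟨m, x⟩ ⟨n, y⟩ ⟨p, q, h, hx, hy⟩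
      simp only at hx hy
      rw [hx, hy]
      refine tmk_eq (.rel _ _ ⟨p, q, h, ?_, ?_⟩)
      · exact f.map_S p
      · exact f.map_S q)
    (by
      intro a b
      refine (dist_tmk_le _ _).trans ?_
      unfold prodDist
      split_ifs
      · linarith [f.short a.2 b.2]
      · exact le_rfl)
    (fun p => congrArg (fun y => tmk (cell p, y)) (f.map_S (rel p)))
  map_id X := by
    apply Hom.ext
    funext t
    obtain ⟨a⟩ := t
    rfl
  map_comp f g := by
    apply Hom.ext
    funext t
    obtain ⟨a⟩ := t
    rfl

variable (X) in
/-- The canonical comparison morphism `δ : M ⊗ C(X) ⟶ C(M ⊗ X)`, which sends `m ⊗ lim xₖ` to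
`lim (m ⊗ xₖ)`. -/
def comparison : tensorFunctor.obj (completionFunctor.obj X) ⟶
    completionFunctor.obj (tensorFunctor.obj X) :=
  have hl : ∀ m : Idx, LipschitzWith (1 / 3) fun x : X => tmk (m, x) := fun m =>
    LipschitzWith.of_dist_le_mul fun x y => (dist_tmk_same m x y).trans (le_of_eq (by
      push_cast; ring))
  have hc : ∀ (m : Idx) (x : X), Completion.map (fun x : X => (tmk (m, x) : Tensor X))
      (x : Completion X) = ((tmk (m, x) : Tensor X) : Completion (Tensor X)) := fun m x =>
    Completion.map_coe (hl m).uniformContinuous x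
  tensorDesc (X := X.completion) (Z := X.tensor.completion)
    (fun a => Completion.map (fun x : X => (tmk (a.1, x) : Tensor X)) a.2)
    (by
      rintro ⟨m, x⟩ ⟨n, y⟩ ⟨p, q, h, hx, hy⟩
      simp only at hx hy
      rw [hx, hy]
      refine (hc m (X.S p)).trans (Eq.trans ?_ (hc n (X.S q)).symm)
      exact congrArg _ (tmk_eq (.rel _ _ ⟨p, q, h, rfl, rfl⟩)))
    (by
      rintro ⟨m, x⟩ ⟨n, y⟩
      unfold prodDist
      split_ifs with h
      · simp only at h
        subst h
        have e : ∀ t : ℝ, ((1 / 3 : NNReal) : ℝ) * t = t / 3 := fun t => by push_cast; ring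
        exact ((hl m).completion_map.dist_le_mul x y).trans (le_of_eq (e _))
      · exact X.tensor.completion.dist_le_two _ _)
    (fun p => hc (cell p) (X.S (rel p)))

end SquaMS

end

noncomputable section

namespace SquaMS

/-! ### The unit square with the taxicab metric -/

/-! The initial algebra is syntactic. Its points are words `m₁ ⊗ ⋯ ⊗ S p`, and the distance of two
words is the supremum, over all algebras, of the distances of their values. Evaluation in any
algebra is then short by construction and unique by induction on words. The unit square with the
taxicab metric is an algebra, which makes the supremum one over a nonempty family and keeps boundary
points apart. The structure map of an initial algebra is invertible by Lambek's lemma.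

The comparison morphism is an isometry, as can be checked on the dense image of `X`. It is onto
because `M ⊗ C(X)` is complete: each copy of a complete `X` sits in `M ⊗ X` with distances shrunk by
at most the factor 3 (`dist_le_three_pathDist`), and there are finitely many copies.

Finality holds for every complete fixed point `Y` of `M ⊗ -`. For a coalgebra `β` on `X` and an
algebra `α` on `Y`, the operator `h ↦ α ∘ (M ⊗ h) ∘ β` contracts uniform distances by 1/3, which
gives uniqueness. For existence one iterates it, but there need not be an evident morphism to start
from. The iteration therefore runs through arbitrary boundary preserving maps. Since distances are
at most 2, such a map is short up to an additive error 2, and each step multiplies the error by 2/3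
(`BdMap.tensorMap_almost_short`), so the limit is short.

That last estimate needs boundary distances in an algebra to be at most those in a coalgebra
(`dist_S_algebra_le_coalgebra`). Only opposite sides matter, since `sq₁` and `sq₂` determine all
other boundary distances. An algebra has crossings of length at most 1 at the heights of Cantor end
points `c`, hence a crossing from height `r` to height `s` of length at most `1 + |r - c| + |s -
c|`. In a coalgebra, crossings cannot be shorter than the infimum of these numbers: if this holds
for `X` up to `ε`, it holds for `M ⊗ X` up to `ε / 2` (`WideUpTo.tensor`), and `β` carries the
better bound back to `X`. -/

/-- The unit square. -/
@[ext]
structure UnitSquare : Type u where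
  x : ℝ
  y : ℝ
  x_mem : x ∈ Set.Icc (0 : ℝ) 1
  y_mem : y ∈ Set.Icc (0 : ℝ) 1

/-- The taxicab metric on the unit square. -/
instance : MetricSpace UnitSquare.{u} where
  dist a b := |a.x - b.x| + |a.y - b.y|
  dist_self a := by simp
  dist_comm a b := by rw [abs_sub_comm a.x, abs_sub_comm a.y]
  dist_triangle a b c := by
    linarith [abs_sub_le a.x b.x c.x, abs_sub_le a.y b.y c.y]
  eq_of_dist_eq_zero := by
    intro a b h
    have h : |a.x - b.x| + |a.y - b.y| = 0 := h
    have h2 := abs_nonneg (a.x - b.x)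
    have h3 := abs_nonneg (a.y - b.y)
    exact UnitSquare.ext (sub_eq_zero.1 (abs_eq_zero.1 (by linarith)))
      (sub_eq_zero.1 (abs_eq_zero.1 (by linarith)))

theorem UnitSquare.dist_def (a b : UnitSquare.{u}) : dist a b = |a.x - b.x| + |a.y - b.y| := rfl

/-- The unit square with the taxicab metric as a square metric space. -/
def unitSquare : SquaMS.{u} where
  carrier := UnitSquare.{u}
  dist_le_two a b := by
    rw [UnitSquare.dist_def]
    have h1 : |a.x - b.x| ≤ 1 := abs_sub_le_of_nonneg_of_le a.x_mem.1 a.x_mem.2 b.x_mem.1 b.x_mem.2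
    have h2 : |a.y - b.y| ≤ 1 := abs_sub_le_of_nonneg_of_le a.y_mem.1 a.y_mem.2 b.y_mem.1 b.y_mem.2
    linarith
  S p := ⟨p.fst, p.snd, p.fst_mem, p.snd_mem⟩
  S_injective p q h := SquareBoundary.ext' (congrArg UnitSquare.x h) (congrArg UnitSquare.y h)
  sq₁_left r s := by
    simp [UnitSquare.dist_def, SquareBoundary.left, SquareBoundary.fst, SquareBoundary.snd,
      abs_sub_comm]
  sq₁_right r s := by
    simp [UnitSquare.dist_def, SquareBoundary.right, SquareBoundary.fst, SquareBoundary.snd,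
      abs_sub_comm]
  sq₁_bottom r s := by
    simp [UnitSquare.dist_def, SquareBoundary.bottom, SquareBoundary.fst, SquareBoundary.snd,
      abs_sub_comm]
  sq₁_top r s := by
    simp [UnitSquare.dist_def, SquareBoundary.top, SquareBoundary.fst, SquareBoundary.snd,
      abs_sub_comm]
  sq₂ p q := le_rfl

/-- The point with relative position `a` in the cell `m` of the subdivided unit square. -/
def UnitSquare.inCell (m : Idx) (a : UnitSquare.{u}) : UnitSquare.{u} where
  x := (m.col + a.x) / 3
  y := (m.row + a.y) / 3
  x_mem := by
    obtain ⟨h1, h2, -, -⟩ := m.bounds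
    obtain ⟨h3, h4⟩ := a.x_mem
    constructor <;> linarith
  y_mem := by
    obtain ⟨-, -, h1, h2⟩ := m.bounds
    obtain ⟨h3, h4⟩ := a.y_mem
    constructor <;> linarith

/-- The unit square as an algebra: `m ⊗ a ↦ (m + a) / 3`. -/
def unitSquareAlgebra : Endofunctor.Algebra tensorFunctor.{u} where
  a := unitSquare
  str := tensorDesc (Z := unitSquare.{u}) (fun c => UnitSquare.inCell c.1 c.2)
    (by
      rintro ⟨m, x⟩ ⟨n, y⟩ ⟨p, q, h, hx, hy⟩
      obtain ⟨h1, h2⟩ := E_pos h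
      simp only at hx hy h1 h2 ⊢
      subst hx hy
      exact UnitSquare.ext (congrArg (· / 3) h1) (congrArg (· / 3) h2))
    (by
      rintro ⟨m, x⟩ ⟨n, y⟩
      unfold prodDist
      split_ifs with h
      · simp only at h
        subst h
        refine le_of_eq ?_
        change |(m.col + UnitSquare.x x) / 3 - (m.col + UnitSquare.x y) / 3| +
          |(m.row + UnitSquare.y x) / 3 - (m.row + UnitSquare.y y) / 3| =
          (|UnitSquare.x x - UnitSquare.x y| + |UnitSquare.y x - UnitSquare.y y|) / 3
        rw [← sub_div, ← sub_div, add_sub_add_left_eq_sub, add_sub_add_left_eq_sub, abs_div,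
          abs_div, abs_of_pos (by norm_num : (0 : ℝ) < 3), add_div]
      · exact unitSquare.dist_le_two _ _)
    (by
      intro p
      obtain ⟨h1, h2⟩ := cell_rel p
      refine UnitSquare.ext ?_ ?_
      · change ((cell p).col + (rel p).fst) / 3 = p.fst
        rw [h1]; ring
      · change ((cell p).row + (rel p).snd) / 3 = p.snd
        rw [h2]; ring)

/-! ### The initial algebra -/

/-- Terms `m₁ ⊗ (m₂ ⊗ ⋯ ⊗ S p)`. -/
structure Term : Type u where
  word : List Idx
  pt : SquareBoundary

/-- The value of a term in an algebra. -/
def evalWord (A : Endofunctor.Algebra tensorFunctor.{u}) : List Idx → SquareBoundary → A.a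
  | [], p => A.a.S p
  | m :: w, p => Hom.toFun A.str (tmk (m, evalWord A w p))

/-- The value of a term in an algebra. -/
def Term.eval (A : Endofunctor.Algebra tensorFunctor.{u}) (t : Term.{u}) : A.a :=
  evalWord A t.word t.pt

/-- The term `m ⊗ t`. -/
def Term.cons (m : Idx) (t : Term.{u}) : Term.{u} := ⟨m :: t.word, t.pt⟩

/-- Boundary points as terms. -/
def Term.bd (p : SquareBoundary) : Term.{u} := ⟨[], p⟩

theorem Term.eval_cons (A : Endofunctor.Algebra tensorFunctor.{u}) (m : Idx) (t : Term.{u}) :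
    (t.cons m).eval A = Hom.toFun A.str (tmk (m, t.eval A)) := rfl

theorem Term.bddAbove_dist (s t : Term.{u}) : BddAbove (Set.range
    fun A : Endofunctor.Algebra tensorFunctor.{u} => dist (s.eval A) (t.eval A)) :=
  ⟨2, by rintro _ ⟨A, rfl⟩; exact A.a.dist_le_two _ _⟩

instance : Nonempty (Endofunctor.Algebra tensorFunctor.{u}) := ⟨unitSquareAlgebra⟩

/-- The distance of two terms is the largest distance of their values in an algebra. -/
instance : PseudoMetricSpace Term.{u} where
  dist s t := ⨆ A : Endofunctor.Algebra tensorFunctor.{u}, dist (s.eval A) (t.eval A)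
  dist_self s := by simp
  dist_comm s t := by simp only [dist_comm]
  dist_triangle s t v := ciSup_le fun A => (dist_triangle _ (t.eval A) _).trans
    (add_le_add (le_ciSup (Term.bddAbove_dist s t) A) (le_ciSup (Term.bddAbove_dist t v) A))

theorem Term.dist_eval_le (A : Endofunctor.Algebra tensorFunctor.{u}) (s t : Term.{u}) :
    dist (s.eval A) (t.eval A) ≤ dist s t := le_ciSup (Term.bddAbove_dist s t) A

theorem Term.dist_le {s t : Term.{u}} {c : ℝ}
    (h : ∀ A : Endofunctor.Algebra tensorFunctor.{u}, dist (s.eval A) (t.eval A) ≤ c) :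
    dist s t ≤ c := ciSup_le h

/-- The upper bound passes to the supremum; the lower bound is read off in one particular algebra.
-/
theorem Term.dist_eq {s t : Term.{u}} {c : ℝ}
    (h : ∀ A : Endofunctor.Algebra tensorFunctor.{u}, dist (s.eval A) (t.eval A) = c) :
    dist s t = c :=
  le_antisymm (Term.dist_le fun A => (h A).le)
    ((h unitSquareAlgebra).symm.le.trans (Term.dist_eval_le _ s t))

theorem Term.dist_cons_le (m : Idx) (s t : Term.{u}) :
    dist (s.cons m) (t.cons m) ≤ dist s t / 3 := by
  refine Term.dist_le fun A => ?_
  rw [Term.eval_cons, Term.eval_cons]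
  refine ((Hom.short A.str _ _).trans (dist_tmk_same m _ _)).trans ?_
  linarith [Term.dist_eval_le A s t]

/-- The square metric space of terms. -/
def termSpace : SquaMS.{u} where
  carrier := SeparationQuotient Term.{u}
  dist_le_two x y := by
    obtain ⟨s, rfl⟩ := SeparationQuotient.surjective_mk x
    obtain ⟨t, rfl⟩ := SeparationQuotient.surjective_mk y
    rw [SeparationQuotient.dist_mk]
    exact Term.dist_le fun A => A.a.dist_le_two _ _
  S p := SeparationQuotient.mk (Term.bd p)
  S_injective p q h := by
    have h1 : dist (Term.bd.{u} p) (Term.bd q) = 0 := by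
      rw [← SeparationQuotient.dist_mk]
      exact dist_eq_zero.2 h
    -- Terms at distance 0 agree in every algebra, in particular in the unit square, where `S` is
    -- injective.
    have h2 := Term.dist_eval_le unitSquareAlgebra (Term.bd.{u} p) (Term.bd q)
    rw [h1] at h2
    exact unitSquareAlgebra.a.S_injective (dist_le_zero.1 h2)
  sq₁_left r s := by
    rw [SeparationQuotient.dist_mk]; exact Term.dist_eq fun A => A.a.sq₁_left r s
  sq₁_right r s := by
    rw [SeparationQuotient.dist_mk]; exact Term.dist_eq fun A => A.a.sq₁_right r s
  sq₁_bottom r s := by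
    rw [SeparationQuotient.dist_mk]; exact Term.dist_eq fun A => A.a.sq₁_bottom r s
  sq₁_top r s := by
    rw [SeparationQuotient.dist_mk]; exact Term.dist_eq fun A => A.a.sq₁_top r s
  sq₂ p q := by
    rw [SeparationQuotient.dist_mk]
    exact (unitSquareAlgebra.{u}.a.sq₂ p q).trans
      (Term.dist_eval_le unitSquareAlgebra (Term.bd p) (Term.bd q))

/-- The action of an index on classes of terms. -/
def termCons (m : Idx) : termSpace.{u} → termSpace.{u} :=
  SeparationQuotient.lift (fun t => SeparationQuotient.mk (Term.cons m t)) fun s t h => by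
    refine SeparationQuotient.mk_eq_mk.2 (Metric.inseparable_iff.2 ?_)
    have h1 := Term.dist_cons_le m s t
    rw [Metric.inseparable_iff.1 h] at h1
    exact le_antisymm (by simpa using h1) dist_nonneg

/-- The algebra of terms. -/
def termAlgebra : Endofunctor.Algebra tensorFunctor.{u} where
  a := termSpace
  str := tensorDesc (Z := termSpace.{u}) (fun c => termCons c.1 c.2)
    (by
      rintro ⟨m, x⟩ ⟨n, y⟩ ⟨p, q, h, hx, hy⟩
      simp only at hx hy ⊢
      subst hx hy
      refine SeparationQuotient.mk_eq_mk.2 (Metric.inseparable_iff.2 (Term.dist_eq fun A => ?_))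
      rw [Term.eval_cons, Term.eval_cons, dist_eq_zero]
      exact congrArg (Hom.toFun A.str) (tmk_eq (.rel _ _ ⟨p, q, h, rfl, rfl⟩)))
    (by
      rintro ⟨m, x⟩ ⟨n, y⟩
      unfold prodDist
      split_ifs with h
      · simp only at h ⊢
        subst h
        obtain ⟨s, rfl⟩ := SeparationQuotient.surjective_mk x
        obtain ⟨t, rfl⟩ := SeparationQuotient.surjective_mk y
        exact Term.dist_cons_le m s t
      · exact termSpace.dist_le_two _ _)
    (by
      intro p
      refine SeparationQuotient.mk_eq_mk.2 (Metric.inseparable_iff.2 (Term.dist_eq fun A => ?_))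
      rw [dist_eq_zero]
      exact Hom.map_S A.str p)

/-- The morphism from the algebra of terms to an algebra. -/
def termHom (A : Endofunctor.Algebra tensorFunctor.{u}) : termAlgebra ⟶ A where
  f :=
    { toFun := SeparationQuotient.lift (Term.eval A) fun s t h => by
        rw [← dist_le_zero, ← Metric.inseparable_iff.1 h]
        exact Term.dist_eval_le A s t
      short := by
        intro x y
        obtain ⟨s, rfl⟩ := SeparationQuotient.surjective_mk x
        obtain ⟨t, rfl⟩ := SeparationQuotient.surjective_mk y
        exact Term.dist_eval_le A s t
      map_S := fun p => rfl }
  h := by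
    apply Hom.ext
    funext t
    obtain ⟨m, x⟩ := t
    obtain ⟨s, rfl⟩ := SeparationQuotient.surjective_mk x
    rfl

/-- Induction on the word: preservation of `S` settles the empty word, compatibility with the
structure maps the rest. -/
theorem termHom_unique (A : Endofunctor.Algebra tensorFunctor.{u}) (f : termAlgebra ⟶ A) :
    f = termHom A := by
  apply Endofunctor.Algebra.Hom.ext
  apply Hom.ext
  funext x
  obtain ⟨⟨w, p⟩, rfl⟩ := SeparationQuotient.surjective_mk x
  induction w with
  | nil => exact Hom.map_S f.f p
  | cons m w ih =>
    have h := congrFun (congrArg Hom.toFun f.h)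
      (tmk (m, (SeparationQuotient.mk (⟨w, p⟩ : Term.{u}) : termSpace.{u})))
    refine h.symm.trans ?_
    exact congrArg (fun y => Hom.toFun A.str (tmk (m, y))) ih

/-- The algebra of terms is initial. -/
def termAlgebraIsInitial : Limits.IsInitial termAlgebra.{u} :=
  Limits.IsInitial.ofUniqueHom termHom termHom_unique

variable {X Y : SquaMS.{u}}

/-! ### Each copy of `X` is embedded in `M ⊗ X`, isometrically up to scaling -/

theorem dist_S_of_fst_eq {p q : SquareBoundary} {i : ℝ} (hi : i = 0 ∨ i = 1) (hp : p.fst = i)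
    (hq : q.fst = i) : dist (X.S p) (X.S q) = |q.snd - p.snd| := by
  rcases hi with rfl | rfl
  · rw [SquareBoundary.eq_left hp, SquareBoundary.eq_left hq]; exact X.sq₁_left _ _
  · rw [SquareBoundary.eq_right hp, SquareBoundary.eq_right hq]; exact X.sq₁_right _ _

theorem dist_S_of_snd_eq {p q : SquareBoundary} {i : ℝ} (hi : i = 0 ∨ i = 1) (hp : p.snd = i)
    (hq : q.snd = i) : dist (X.S p) (X.S q) = |q.fst - p.fst| := by
  rcases hi with rfl | rfl
  · rw [SquareBoundary.eq_bottom hp, SquareBoundary.eq_bottom hq]; exact X.sq₁_bottom _ _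
  · rw [SquareBoundary.eq_top hp, SquareBoundary.eq_top hq]; exact X.sq₁_top _ _

/-- Used to extend the two coordinate functions from the boundary to all of `X`; truncation at 1
keeps their values in the unit interval. -/
theorem exists_coord_extension (φ : SquareBoundary → ℝ)
    (hφ : ∀ p q, |φ p - φ q| ≤ |p.fst - q.fst| + |p.snd - q.snd|)
    (h01 : ∀ p, 0 ≤ φ p ∧ φ p ≤ 1) :
    ∃ g : X → ℝ, (∀ x y, |g x - g y| ≤ dist x y) ∧ (∀ x, 0 ≤ g x ∧ g x ≤ 1) ∧
      ∀ p, g (X.S p) = φ p := by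
  obtain ⟨g, hg, hb, hS⟩ := exists_extension (X := X) φ 0 hφ
    (fun p => ⟨(h01 p).1, by linarith [(h01 p).2]⟩)
  refine ⟨fun x => min (g x) 1, fun x y => ?_, fun x => ?_, fun p => ?_⟩
  · refine (abs_min_sub_min_le_max _ _ _ _).trans ?_
    rw [sub_self, abs_zero]
    exact max_le (hg x y) dist_nonneg
  · exact ⟨le_min (hb x).1 zero_le_one, min_le_right _ _⟩
  · simp only [hS, min_eq_left (h01 p).2]

/-- The nearest point of the unit interval. -/
def clamp (t : ℝ) : ℝ := max 0 (min t 1)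

theorem clamp_mem (t : ℝ) : clamp t ∈ Set.Icc (0 : ℝ) 1 :=
  ⟨le_max_left _ _, max_le zero_le_one (min_le_right _ _)⟩

theorem abs_clamp_sub_le (s t : ℝ) : |clamp s - clamp t| ≤ |s - t| := by
  refine (abs_max_sub_max_le_max _ _ _ _).trans (max_le (by simp) ?_)
  exact (abs_min_sub_min_le_max _ _ _ _).trans (max_le le_rfl (by simp))

theorem clamp_of_mem {t : ℝ} (h : t ∈ Set.Icc (0 : ℝ) 1) : clamp t = t := by
  rw [clamp, min_eq_left h.2, max_eq_right h.1]

theorem clamp_eq_zero {t : ℝ} (h : t ≤ 0) : clamp t = 0 :=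
  max_eq_left ((min_le_left _ _).trans h)

theorem clamp_eq_one {t : ℝ} (h : 1 ≤ t) : clamp t = 1 := by
  rw [clamp, min_eq_right h, max_eq_right zero_le_one]

/-- Distinct unit intervals of the grid meet at most in an end point, so one is clamped to a single
end of the other. -/
theorem clamp_shift_of_ne {i k : Fin 3} (h : i ≠ k) :
    ∃ e : ℝ, (e = 0 ∨ e = 1) ∧
      ∀ t ∈ Set.Icc (0 : ℝ) 1, clamp (((i : ℕ) : ℝ) + t - ((k : ℕ) : ℝ)) = e := by
  rcases lt_or_gt_of_ne (fun e => h (Fin.ext e) : (i : ℕ) ≠ k) with hlt | hlt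
  · have h1 : ((i : ℕ) : ℝ) + 1 ≤ ((k : ℕ) : ℝ) := by exact_mod_cast hlt
    exact ⟨0, Or.inl rfl, fun t ht => clamp_eq_zero (by linarith [ht.2])⟩
  · have h1 : ((k : ℕ) : ℝ) + 1 ≤ ((i : ℕ) : ℝ) := by exact_mod_cast hlt
    exact ⟨1, Or.inr rfl, fun t ht => clamp_eq_one (by linarith [ht.1])⟩

theorem Idx.fst_ne_or_snd_ne {m n : Idx} (h : n ≠ m) : n.1.1 ≠ m.1.1 ∨ n.1.2 ≠ m.1.2 := by
  by_contra hc
  rw [not_or, not_not, not_not] at hc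
  exact h (Subtype.ext (Prod.ext hc.1 hc.2))

/-- The point of the cell `m` that is nearest to the point with relative position `(a, b)` in
another cell. -/
def clampPoint (m n : Idx) (h : n ≠ m) (a b : Set.Icc (0 : ℝ) 1) : SquareBoundary :=
  ⟨(clamp (n.col + a - m.col), clamp (n.row + b - m.row)), clamp_mem _, clamp_mem _, by
    rcases Idx.fst_ne_or_snd_ne h with h | h
    · obtain ⟨e, he, h⟩ := clamp_shift_of_ne h
      exact Or.inl (by
        change clamp (n.col + a - m.col) = 0 ∨ clamp (n.col + a - m.col) = 1
        rw [show clamp (n.col + a - m.col) = e from h a a.2]; exact he)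
    · obtain ⟨e, he, h⟩ := clamp_shift_of_ne h
      exact Or.inr (by
        change clamp (n.row + b - m.row) = 0 ∨ clamp (n.row + b - m.row) = 1
        rw [show clamp (n.row + b - m.row) = e from h b b.2]; exact he)⟩

/-- Distinct cells differ in column or row, so all of cell `n` is clamped to one side of cell `m`,
where `sq₁` gives the distance. Hence only one coordinate difference enters, not their sum. -/
theorem dist_clampPoint_le (m n : Idx) (h : n ≠ m) (a b a' b' : Set.Icc (0 : ℝ) 1) {c : ℝ}
    (ha : |(a : ℝ) - a'| ≤ c) (hb : |(b : ℝ) - b'| ≤ c) :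
    dist (X.S (clampPoint m n h a b)) (X.S (clampPoint m n h a' b')) ≤ c := by
  rcases Idx.fst_ne_or_snd_ne h with h' | h'
  · obtain ⟨e, he, h'⟩ := clamp_shift_of_ne h'
    rw [dist_S_of_fst_eq (p := clampPoint m n h a b) (q := clampPoint m n h a' b') he (h' a a.2)
      (h' a' a'.2), abs_sub_comm]
    refine (abs_clamp_sub_le _ _).trans ?_
    rwa [sub_sub_sub_cancel_right, add_sub_add_left_eq_sub]
  · obtain ⟨e, he, h'⟩ := clamp_shift_of_ne h'
    rw [dist_S_of_snd_eq (p := clampPoint m n h a b) (q := clampPoint m n h a' b') he (h' b b.2)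
      (h' b' b'.2), abs_sub_comm]
    refine (abs_clamp_sub_le _ _).trans ?_
    rwa [sub_sub_sub_cancel_right, add_sub_add_left_eq_sub]

/-- A map on `M × X` that respects the identifications and is short up to the factor `3` on each
copy of `X` and between different copies. -/
theorem dist_le_of_prodDist {Z : Type*} [PseudoMetricSpace Z] (F : Idx × X → Z)
    (hF : ∀ a b, Glue X a b → F a = F b)
    (hd : ∀ a b, dist (F a) (F b) ≤ 3 * prodDist X a b) (a b : Idx × X) :
    dist (F a) (F b) ≤ 3 * pathDist X a b := by
  -- The rescaling by 3 is done on the real-valued function "distance from `F a`" instead of on the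
  -- metric of `Z`.
  have := short_of_prodDist (X := X) (fun c => dist (F a) (F c) / 3)
    (fun c d h => by simp only [hF c d h])
    (fun c d => by
      have h1 := hd c d
      have h2 : |dist (F a) (F c) - dist (F a) (F d)| ≤ dist (F c) (F d) := by
        rw [dist_comm (F a), dist_comm (F a)]; exact abs_dist_sub_le _ _ _
      rw [Real.dist_eq, ← sub_div, abs_div, abs_of_pos (by norm_num : (0 : ℝ) < 3)]
      linarith) a b
  rw [dist_self, zero_div, Real.dist_eq, zero_sub, abs_neg, abs_of_nonneg (by positivity)] at this
  linarith

/-- There is a retraction of `M × X` onto copy `m`: the other copies are projected to the boundary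
of cell `m` by clamping grid coordinates. It respects the gluing because glued points have the same
grid position. -/
theorem dist_le_three_pathDist (m : Idx) (x y : X) :
    dist x y ≤ 3 * pathDist X (m, x) (m, y) := by
  obtain ⟨ξ, hξ, hξ1, hξS⟩ := exists_coord_extension (X := X) SquareBoundary.fst
    (fun p q => le_add_of_nonneg_right (abs_nonneg _)) (fun p => p.fst_mem)
  obtain ⟨υ, hυ, hυ1, hυS⟩ := exists_coord_extension (X := X) SquareBoundary.snd
    (fun p q => le_add_of_nonneg_left (abs_nonneg _)) (fun p => p.snd_mem)
  -- `ξ` and `υ` serve as short substitutes for the coordinates of interior points of `X`.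
  let F : Idx × X → X := fun c =>
    if h : c.1 = m then c.2 else X.S (clampPoint m c.1 h ⟨ξ c.2, hξ1 c.2⟩ ⟨υ c.2, hυ1 c.2⟩)
  have hF1 : ∀ z, F (m, z) = z := fun z => dif_pos rfl
  have hF2 : ∀ n z (h : n ≠ m),
      F (n, z) = X.S (clampPoint m n h ⟨ξ z, hξ1 z⟩ ⟨υ z, hυ1 z⟩) := fun n z h => dif_neg h
  have hFS : ∀ n p, ∃ r : SquareBoundary, F (n, X.S p) = X.S r ∧
      r.fst = clamp (n.col + p.fst - m.col) ∧ r.snd = clamp (n.row + p.snd - m.row) := by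
    intro n p
    by_cases h : n = m
    · subst h
      refine ⟨p, hF1 _, ?_, ?_⟩
      · rw [add_sub_cancel_left, clamp_of_mem p.fst_mem]
      · rw [add_sub_cancel_left, clamp_of_mem p.snd_mem]
    · refine ⟨_, hF2 _ _ h, ?_, ?_⟩
      · rw [← hξS p]; rfl
      · rw [← hυS p]; rfl
  have key := dist_le_of_prodDist F ?_ ?_ (m, x) (m, y)
  · rwa [hF1, hF1] at key
  · rintro ⟨n, z⟩ ⟨k, w⟩ ⟨p, q, h, hz, hw⟩
    simp only at hz hw
    subst hz hw
    obtain ⟨r, hr, hr1, hr2⟩ := hFS n p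
    obtain ⟨s, hs, hs1, hs2⟩ := hFS k q
    obtain ⟨h1, h2⟩ := E_pos h
    simp only at h1 h2
    rw [hr, hs]
    congr 1
    exact SquareBoundary.ext' (by rw [hr1, hs1, h1]) (by rw [hr2, hs2, h2])
  · rintro ⟨n, z⟩ ⟨k, w⟩
    unfold prodDist
    split_ifs with h
    · simp only at h ⊢
      subst h
      rw [mul_div_cancel₀ _ (by norm_num : (3 : ℝ) ≠ 0)]
      by_cases h : n = m
      · subst h; rw [hF1, hF1]
      · rw [hF2 _ _ h, hF2 _ _ h]
        exact dist_clampPoint_le _ _ _ _ _ _ _ (hξ z w) (hυ z w)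
    · exact (X.dist_le_two _ _).trans (by norm_num)

/-! ### Completeness of `M ⊗ X` and the comparison morphism -/

theorem lipschitz_tmk (m : Idx) : LipschitzWith (1 / 3) fun x : X => (tmk (m, x) : Tensor X) :=
  LipschitzWith.of_dist_le_mul fun x y => (dist_tmk_same m x y).trans (le_of_eq (by
    push_cast; ring))

theorem isComplete_range_tmk [CompleteSpace X] (m : Idx) :
    IsComplete (Set.range fun x : X => (tmk (m, x) : Tensor X)) := by
  have h1 : AntilipschitzWith 3 fun x : X => (tmk (m, x) : Tensor X) :=
    AntilipschitzWith.of_le_mul_dist fun x y => dist_le_three_pathDist m x y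
  exact h1.isComplete_range (lipschitz_tmk m).uniformContinuous

instance [CompleteSpace X] : CompleteSpace (Tensor X) := by
  refine completeSpace_of_isComplete_univ ?_
  have h : (Set.univ : Set (Tensor X)) =
      ⋃ m : Idx, Set.range fun x : X => (tmk (m, x) : Tensor X) := by
    refine (Set.eq_univ_of_forall ?_).symm
    rintro ⟨m, x⟩
    exact Set.mem_iUnion.2 ⟨m, x, rfl⟩
  have hf : ∀ s : Finset Idx, IsComplete
      (⋃ m ∈ s, Set.range fun x : X => (tmk (m, x) : Tensor X)) := by
    intro s
    induction s using Finset.induction_on with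
    | empty =>
      intro f hf hs
      simp only [Finset.notMem_empty, Set.iUnion_of_empty, Set.iUnion_empty,
        Filter.principal_empty, le_bot_iff] at hs
      exact absurd hs hf.1.ne
    | insert m s _ ih =>
      rw [Finset.set_biUnion_insert]
      exact (isComplete_range_tmk m).union ih
  rw [h]
  simpa using hf Finset.univ

/-- A surjective isometric morphism is an isomorphism. -/
theorem isIso_of_isometry (f : X ⟶ Y) (hf : Isometry (Hom.toFun f))
    (hs : Function.Surjective (Hom.toFun f)) : IsIso f := by
  let e := Equiv.ofBijective (Hom.toFun f) ⟨hf.injective, hs⟩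
  have he : ∀ x, e x = Hom.toFun f x := fun _ => rfl
  refine ⟨⟨⟨e.symm, fun x y => ?_, fun p => ?_⟩, ?_, ?_⟩⟩
  · rw [← hf.dist_eq, ← he, ← he, e.apply_symm_apply, e.apply_symm_apply]
  · rw [e.symm_apply_eq, he, Hom.map_S]
  · apply Hom.ext
    funext x
    exact e.symm_apply_apply x
  · apply Hom.ext
    funext x
    exact e.apply_symm_apply x

theorem comparison_coe (m : Idx) (x : X) :
    Hom.toFun (comparison X) (tmk (X := X.completion) (m, (x : Completion X))) =
      ((tmk (m, x) : Tensor X) : Completion (Tensor X)) := by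
  exact Completion.map_coe (lipschitz_tmk m).uniformContinuous x

/-- The canonical morphism from a square metric space to its completion. -/
def toCompletion (X : SquaMS.{u}) : X ⟶ completionFunctor.obj X where
  toFun x := (x : Completion X)
  short x y := (Completion.dist_eq x y).le
  map_S _ := rfl

/-- By density it suffices to consider points `m ⊗ x` with `x` in `X`. One inequality is shortness
of the comparison. The other is shortness of `M ⊗ -` applied to `X → C(X)`, since the comparison
sends `m ⊗ x` to its isometric image in `C(M ⊗ X)`. -/
theorem isometry_comparison (X : SquaMS.{u}) : Isometry (Hom.toFun (comparison X)) := by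
  refine Isometry.of_dist_eq ?_
  rintro ⟨m, x⟩ ⟨n, y⟩
  change dist (Hom.toFun (comparison X) (tmk (X := X.completion) (m, x)))
    (Hom.toFun (comparison X) (tmk (X := X.completion) (n, y))) =
    dist (tmk (X := X.completion) (m, x)) (tmk (X := X.completion) (n, y))
  have hc : Continuous (Hom.toFun (comparison X)) := (Hom.lipschitz (comparison X)).continuous
  have h1 : ∀ k : Idx, Continuous fun z : Completion X => tmk (X := X.completion) (k, z) :=
    fun k => (lipschitz_tmk (X := X.completion) k).continuous
  revert y
  revert x
  intro (x : Completion X) (y : Completion X)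
  induction x, y using Completion.induction_on₂ with
  | hp =>
    exact isClosed_eq
      ((hc.comp ((h1 m).comp continuous_fst)).dist (hc.comp ((h1 n).comp continuous_snd)))
      (((h1 m).comp continuous_fst).dist ((h1 n).comp continuous_snd))
  | ih x y =>
    refine le_antisymm (Hom.short (comparison X) _ _) ?_
    rw [comparison_coe, comparison_coe]
    refine le_trans ?_ (Completion.dist_eq _ _).ge
    exact Hom.short (tensorFunctor.map (toCompletion X)) (tmk (m, x)) (tmk (n, y))

/-- The range is closed, being an isometric image of a complete space, and contains the dense image
of `M ⊗ X`. -/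
theorem isIso_comparison (X : SquaMS.{u}) : IsIso (comparison X) := by
  refine isIso_of_isometry _ (isometry_comparison X) ?_
  have : CompleteSpace X.completion := inferInstanceAs (CompleteSpace (Completion X))
  have : CompleteSpace (tensorFunctor.obj (completionFunctor.obj X)) :=
    inferInstanceAs (CompleteSpace (Tensor X.completion))
  have h1 : IsClosed (Set.range (Hom.toFun (comparison X))) :=
    (isometry_comparison X).isClosedEmbedding.isClosed_range
  intro z
  change z ∈ Set.range (Hom.toFun (comparison X))
  induction z using Completion.induction_on with
  | hp => exact h1
  | ih t =>
    obtain ⟨m, x⟩ := t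
    exact ⟨_, comparison_coe m x⟩

/-! ### Distances of boundary points of `M ⊗ X` -/

/-- Functions on the boundaries of the cells that are consistent and short for the scaled metric
bound the path metric from below. -/
theorem abs_sub_le_pathDist (φ : Idx → SquareBoundary → ℝ)
    (h02 : ∀ m p, 0 ≤ φ m p ∧ φ m p ≤ 2)
    (hφ : ∀ m p q, |φ m p - φ m q| ≤ dist (X.S p) (X.S q) / 3)
    (hE : ∀ m n p q, E (m, p) (n, q) → φ m p = φ n q) (m n : Idx) (p q : SquareBoundary) :
    |φ m p - φ n q| ≤ pathDist X (m, X.S p) (n, X.S q) := by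
  have hext : ∀ m, ∃ g : X → ℝ, (∀ x y, |g x - g y| ≤ dist x y / 3) ∧
      (∀ x, 0 ≤ g x ∧ g x ≤ 2) ∧ ∀ p, g (X.S p) = φ m p := by
    intro m
    let f : X → ℝ := Function.extend X.S (φ m) 0
    have hf : ∀ p, f (X.S p) = φ m p := fun p => X.S_injective.extend_apply (φ m) 0 p
    have e : ∀ t : ℝ, ((1 / 3 : NNReal) : ℝ) * t = t / 3 := fun t => by push_cast; ring
    have hl : LipschitzOnWith (1 / 3) f (Set.range X.S) := by
      refine LipschitzOnWith.of_dist_le_mul ?_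
      rintro _ ⟨p, rfl⟩ _ ⟨q, rfl⟩
      rw [hf, hf, Real.dist_eq, e]
      exact hφ m p q
    obtain ⟨g, hg, hfg⟩ := hl.extend_real
    refine ⟨fun x => max 0 (min (g x) 2), fun x y => ?_, fun x => ?_, fun p => ?_⟩
    · have h1 : |g x - g y| ≤ dist x y / 3 := by
        rw [← e, ← Real.dist_eq]; exact hg.dist_le_mul x y
      have h0 : 0 ≤ dist x y / 3 := by positivity
      refine (abs_max_sub_max_le_max _ _ _ _).trans (max_le (by simpa using h0) ?_)
      exact (abs_min_sub_min_le_max _ _ _ _).trans (max_le h1 (by simpa using h0))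
    · exact ⟨le_max_left _ _, max_le zero_le_two (min_le_right _ _)⟩
    · have h1 : g (X.S p) = φ m p := by rw [← hf p, hfg ⟨p, rfl⟩]
      simp only [h1, min_eq_left (h02 m p).2, max_eq_right (h02 m p).1]
  choose g hg hb hS using hext
  have := short_of_prodDist (X := X) (fun c => g c.1 c.2) ?_ ?_ (m, X.S p) (n, X.S q)
  · simpa only [Real.dist_eq, hS] using this
  · rintro ⟨m, x⟩ ⟨n, y⟩ ⟨p, q, h, hx, hy⟩
    simp only at hx hy h ⊢
    rw [hx, hy, hS, hS, hE _ _ _ _ h]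
  · rintro ⟨m, x⟩ ⟨n, y⟩
    unfold prodDist
    simp only [Real.dist_eq]
    split_ifs with h
    · subst h; exact hg m x y
    · have h1 := hb m x
      have h2 := hb n y
      rw [abs_le]
      constructor <;> linarith [h1.1, h1.2, h2.1, h2.2]

/-! ### Cantor end points and detours -/

/-- The end points of the intervals that are removed from the unit interval to obtain the Cantor
set. -/
inductive IsCantorEnd : ℝ → Prop
  | zero : IsCantorEnd 0
  | one : IsCantorEnd 1
  | low {c : ℝ} : IsCantorEnd c → IsCantorEnd (c / 3)
  | high {c : ℝ} : IsCantorEnd c → IsCantorEnd ((2 + c) / 3)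

theorem IsCantorEnd.mem {c : ℝ} (h : IsCantorEnd c) : c ∈ Set.Icc (0 : ℝ) 1 := by
  induction h with
  | zero => simp
  | one => simp
  | low h ih => constructor <;> linarith [ih.1, ih.2]
  | high h ih => constructor <;> linarith [ih.1, ih.2]

theorem IsCantorEnd.shift {c : ℝ} (h : IsCantorEnd c) {j : Fin 3} (hj : j ≠ 1) :
    IsCantorEnd ((((j : ℕ) : ℝ) + c) / 3) := by
  have : j = 0 ∨ j = 2 := by omega
  rcases this with rfl | rfl
  · simpa using h.low
  · simpa using h.high

theorem isCantorEnd_third (j : Fin 3) {b : ℝ} (hb : b = 0 ∨ b = 1) :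
    IsCantorEnd ((((j : ℕ) : ℝ) + b) / 3) := by
  by_cases hj : j = 1
  · subst hj
    rcases hb with rfl | rfl
    · simpa using IsCantorEnd.one.low
    · have := IsCantorEnd.zero.high
      norm_num at this ⊢
      exact this
  · refine IsCantorEnd.shift ?_ hj
    rcases hb with rfl | rfl
    · exact .zero
    · exact .one

/-- The length of the shortest way on the real line from `r` to `y` via a Cantor end point. -/
def detour (r y : ℝ) : ℝ := ⨅ c : {c : ℝ // IsCantorEnd c}, (|r - c| + |y - c|)

instance : Nonempty {c : ℝ // IsCantorEnd c} := ⟨⟨0, .zero⟩⟩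

theorem detour_le {r y c : ℝ} (hc : IsCantorEnd c) : detour r y ≤ |r - c| + |y - c| :=
  ciInf_le (f := fun c : {c : ℝ // IsCantorEnd c} => |r - c| + |y - c|)
    ⟨0, by rintro _ ⟨c, rfl⟩; positivity⟩ ⟨c, hc⟩

theorem exists_lt_of_detour_lt {r y t : ℝ} (h : detour r y < t) :
    ∃ c, IsCantorEnd c ∧ |r - c| + |y - c| < t := by
  obtain ⟨⟨c, hc⟩, h⟩ := exists_lt_of_ciInf_lt h
  exact ⟨c, hc, h⟩

theorem detour_sub_le (r y y' : ℝ) : detour r y - detour r y' ≤ |y - y'| := by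
  have h : detour r y - |y - y'| ≤ detour r y' := by
    refine le_ciInf fun c => ?_
    have := detour_le (r := r) (y := y) c.2
    linarith [abs_sub_le y y' (c : ℝ)]
  linarith

/-- A distance on a vertical line from the height `r`, allowing for detours. -/
def height (ε r y : ℝ) : ℝ := max (detour r y - ε) |y - r|

theorem abs_height_sub_le (ε r y y' : ℝ) : |height ε r y - height ε r y'| ≤ |y - y'| := by
  refine (abs_max_sub_max_le_max _ _ _ _).trans (max_le ?_ ?_)
  · rw [sub_sub_sub_cancel_right]
    refine abs_le.2 ⟨?_, detour_sub_le r y y'⟩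
    have := detour_sub_le r y' y
    rw [abs_sub_comm] at this
    linarith
  · refine (abs_abs_sub_abs_le_abs_sub _ _).trans ?_
    rw [sub_sub_sub_cancel_right]

/-- At a Cantor end point the detour may go through `y` itself and costs nothing extra. -/
theorem height_of_isCantorEnd {ε r y : ℝ} (hε : 0 ≤ ε) (hy : IsCantorEnd y) :
    height ε r y = |y - r| := by
  refine max_eq_right ?_
  have := detour_le (r := r) (y := y) hy
  rw [sub_self, abs_zero, add_zero, abs_sub_comm] at this
  linarith

theorem height_mem {ε r y : ℝ} (hε : 0 ≤ ε) (hr : r ∈ Set.Icc (0 : ℝ) 1)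
    (hy : y ∈ Set.Icc (0 : ℝ) 1) : 0 ≤ height ε r y ∧ height ε r y ≤ 1 := by
  have h1 := detour_le (r := r) (y := y) .zero
  have h2 := detour_le (r := r) (y := y) .one
  obtain ⟨h3, h4⟩ := hr
  obtain ⟨h5, h6⟩ := hy
  rw [sub_zero, sub_zero, abs_of_nonneg h3, abs_of_nonneg h5] at h1
  rw [abs_of_nonpos (by linarith), abs_of_nonpos (by linarith)] at h2
  refine ⟨(abs_nonneg _).trans (le_max_right _ _), max_le (by linarith) ?_⟩
  rw [abs_le]; constructor <;> linarith

/-! ### Lower bounds for crossings in coalgebras -/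

/-- A lower bound for the distance from the point of height `r` on the left side to the point with
relative position `(a, b)` in the cell `(i, j)`. -/
def crossFun (ε r : ℝ) (i j : Fin 3) (a b : ℝ) : ℝ :=
  (((i : ℕ) : ℝ) + a) / 3 + if i = 0 ∧ (j = 1 ∨ a < 1) then |(((j : ℕ) : ℝ) + b) / 3 - r|
    else height ε r ((((j : ℕ) : ℝ) + b) / 3)

/-- The two branches of `crossFun` agree wherever cells are glued. The hypothesis covers horizontal
sides, whose heights are multiples of 1/3 and hence Cantor end points, and right sides in the first
column except beside the hole, where nothing is glued. -/
theorem crossFun_eq {ε r : ℝ} (hε : 0 ≤ ε) {i j : Fin 3} {a b : ℝ}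
    (h : (b = 0 ∨ b = 1) ∨ i ≠ 0 ∨ (j ≠ 1 ∧ a = 1)) :
    crossFun ε r i j a b =
      (((i : ℕ) : ℝ) + a) / 3 + height ε r ((((j : ℕ) : ℝ) + b) / 3) := by
  unfold crossFun
  split_ifs with hc
  · rcases h with h | h | ⟨h, h'⟩
    · rw [height_of_isCantorEnd hε (isCantorEnd_third j h)]
    · exact absurd hc.1 h
    · rcases hc.2 with h2 | h2
      · exact absurd h2 h
      · exact absurd h' h2.ne
  · rfl

theorem third_mem (j : Fin 3) {b : ℝ} (hb : b ∈ Set.Icc (0 : ℝ) 1) :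
    (((j : ℕ) : ℝ) + b) / 3 ∈ Set.Icc (0 : ℝ) 1 := by
  have h1 : ((j : ℕ) : ℝ) ≤ 2 := by
    have : (j : ℕ) ≤ 2 := by omega
    exact_mod_cast this
  have h2 : (0 : ℝ) ≤ ((j : ℕ) : ℝ) := Nat.cast_nonneg _
  constructor <;> linarith [hb.1, hb.2]

theorem crossFun_mem {ε r : ℝ} (hε : 0 ≤ ε) (hr : r ∈ Set.Icc (0 : ℝ) 1) (i j : Fin 3) {a b : ℝ}
    (ha : a ∈ Set.Icc (0 : ℝ) 1) (hb : b ∈ Set.Icc (0 : ℝ) 1) :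
    0 ≤ crossFun ε r i j a b ∧ crossFun ε r i j a b ≤ 2 := by
  have h1 := third_mem i ha
  have h2 := third_mem j hb
  have h3 := height_mem hε hr h2
  unfold crossFun
  split_ifs
  · have h4 : |(((j : ℕ) : ℝ) + b) / 3 - r| ≤ 1 := by
      rw [abs_le]; constructor <;> linarith [hr.1, hr.2, h2.1, h2.2]
    have h5 := abs_nonneg ((((j : ℕ) : ℝ) + b) / 3 - r)
    constructor <;> linarith [h1.1, h1.2]
  · constructor <;> linarith [h1.1, h1.2, h3.1, h3.2]

/-- `d` is a bound for the distance of points of opposite sides with heights `b` and `b'`, up to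
`ε`. -/
def CrossLE (ε b b' d : ℝ) : Prop := ∃ c, IsCantorEnd c ∧ 1 + |b - c| + |b' - c| ≤ d + ε

theorem CrossLE.symm {ε b b' d : ℝ} (h : CrossLE ε b b' d) : CrossLE ε b' b d := by
  obtain ⟨c, hc, h⟩ := h
  exact ⟨c, hc, by linarith⟩

theorem abs_third_sub (j a b : ℝ) : |(j + a) / 3 - (j + b) / 3| = |a - b| / 3 := by
  rw [← sub_div, add_sub_add_left_eq_sub, abs_div, abs_of_pos (by norm_num : (0 : ℝ) < 3)]

/-- A crossing of a first-column cell pays for the change from `|y - r|` to `height`. The Cantor end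
point `c` for the cell gives the Cantor end point `C = (j + c) / 3`, as `j ≠ 1`, and the detour from
`r` via `C` to `y'` is at most `|r - y| + |y - C| + |y' - C|`. -/
theorem abs_height_sub_le_of_cross {ε r d b b' : ℝ} {j : Fin 3} (hj : j ≠ 1)
    (hd : 1 + |b - b'| ≤ d) (hc : CrossLE ε b b' d) :
    |(1 / 3 + height (ε / 3) r ((((j : ℕ) : ℝ) + b') / 3)) -
      (|(((j : ℕ) : ℝ) + b) / 3 - r|)| ≤ d / 3 := by
  obtain ⟨c, hc, h⟩ := hc
  have hC := hc.shift hj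
  set y := (((j : ℕ) : ℝ) + b) / 3 with hy
  set y' := (((j : ℕ) : ℝ) + b') / 3 with hy'
  set C := (((j : ℕ) : ℝ) + c) / 3 with hC'
  have e1 : |y - y'| = |b - b'| / 3 := abs_third_sub _ _ _
  have e2 : |y - C| = |b - c| / 3 := abs_third_sub _ _ _
  have e3 : |y' - C| = |b' - c| / 3 := abs_third_sub _ _ _
  have h1 := detour_le (r := r) (y := y') hC
  have h2 := abs_sub_le r y C
  have h3 := abs_sub_comm r y
  have h4 := abs_sub_le y y' r
  have h5 := abs_sub_le y' y r
  rw [abs_sub_comm y' y] at h5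
  have h6 : height (ε / 3) r y' ≤ |y - r| + d / 3 - 1 / 3 := max_le (by linarith) (by linarith)
  have h7 : |y' - r| ≤ height (ε / 3) r y' := le_max_right _ _
  rw [abs_le]
  constructor <;> linarith

/-- Within one branch, `crossFun` is short for the scaled taxicab metric. The branch changes only at
the right side of a corner cell in the first column; there either the other point lies on a
horizontal side, where the branches agree, or the cell is crossed. -/
theorem abs_crossFun_sub_le {ε r d : ℝ} (hε : 0 ≤ ε) (i j : Fin 3) {a b a' b' : ℝ}
    (ha : a ≤ 1) (ha' : a' ≤ 1)
    (hab : (a = 0 ∨ a = 1) ∨ (b = 0 ∨ b = 1)) (hab' : (a' = 0 ∨ a' = 1) ∨ (b' = 0 ∨ b' = 1))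
    (hd : |a - a'| + |b - b'| ≤ d) (hc : a = 0 → a' = 1 → CrossLE ε b b' d)
    (hc' : a = 1 → a' = 0 → CrossLE ε b b' d) :
    |crossFun (ε / 3) r i j a b - crossFun (ε / 3) r i j a' b'| ≤ d / 3 := by
  have hε3 : 0 ≤ ε / 3 := by positivity
  have taxi : ∀ f : ℝ → ℝ, (∀ y y', |f y - f y'| ≤ |y - y'|) →
      |((((i : ℕ) : ℝ) + a) / 3 + f ((((j : ℕ) : ℝ) + b) / 3)) -
        ((((i : ℕ) : ℝ) + a') / 3 + f ((((j : ℕ) : ℝ) + b') / 3))| ≤ d / 3 := by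
    intro f hf
    rw [add_sub_add_comm]
    refine (abs_add_le _ _).trans ?_
    have := hf ((((j : ℕ) : ℝ) + b) / 3) ((((j : ℕ) : ℝ) + b') / 3)
    rw [abs_third_sub] at this ⊢
    linarith
  have habs : ∀ y y' : ℝ, |(|y - r|) - (|y' - r|)| ≤ |y - y'| := fun y y' => by
    refine (abs_abs_sub_abs_le_abs_sub _ _).trans ?_
    rw [sub_sub_sub_cancel_right]
  have hheight := abs_height_sub_le (ε / 3) r
  by_cases h1 : i = 0 ∧ (j = 1 ∨ a < 1) <;> by_cases h2 : i = 0 ∧ (j = 1 ∨ a' < 1)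
  · rw [crossFun, crossFun, if_pos h1, if_pos h2]
    exact taxi (fun y => |y - r|) habs
  · obtain ⟨rfl, h1'⟩ := h1
    have hj : j ≠ 1 := fun h => h2 ⟨rfl, Or.inl h⟩
    have ha'1 : a' = 1 := le_antisymm ha' (not_lt.1 fun h => h2 ⟨rfl, Or.inr h⟩)
    have ha1 : a < 1 := h1'.resolve_left hj
    by_cases hb : b = 0 ∨ b = 1
    · rw [crossFun_eq hε3 (Or.inl hb), crossFun_eq hε3 (Or.inr (Or.inr ⟨hj, ha'1⟩))]
      exact taxi _ hheight
    · have ha0 : a = 0 := (hab.resolve_right hb).resolve_right ha1.ne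
      subst ha0 ha'1
      rw [abs_sub_comm, crossFun, crossFun, if_neg h2, if_pos ⟨rfl, h1'⟩]
      have := abs_height_sub_le_of_cross (r := r) hj (by simpa using hd) (hc rfl rfl)
      simpa using this
  · obtain ⟨rfl, h2'⟩ := h2
    have hj : j ≠ 1 := fun h => h1 ⟨rfl, Or.inl h⟩
    have ha1 : a = 1 := le_antisymm ha (not_lt.1 fun h => h1 ⟨rfl, Or.inr h⟩)
    have ha'1 : a' < 1 := h2'.resolve_left hj
    by_cases hb : b' = 0 ∨ b' = 1
    · rw [crossFun_eq hε3 (Or.inr (Or.inr ⟨hj, ha1⟩)), crossFun_eq hε3 (Or.inl hb)]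
      exact taxi _ hheight
    · have ha0 : a' = 0 := (hab'.resolve_right hb).resolve_right ha'1.ne
      subst ha0 ha1
      rw [crossFun, crossFun, if_neg h1, if_pos ⟨rfl, h2'⟩]
      have := abs_height_sub_le_of_cross (r := r) hj (by simpa [abs_sub_comm] using hd)
        (hc' rfl rfl).symm
      simpa using this
  · rw [crossFun, crossFun, if_neg h1, if_neg h2]
    exact taxi _ hheight

/-- The hypothesis of `crossFun_eq` for glued points, for horizontal crossings and with the axes
interchanged. -/
theorem E_side {m n : Idx} {p q : SquareBoundary} (h : E (m, p) (n, q)) :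
    (((p.snd = 0 ∨ p.snd = 1) ∨ m.1.1 ≠ 0 ∨ (m.1.2 ≠ 1 ∧ p.fst = 1)) ∧
      ((q.snd = 0 ∨ q.snd = 1) ∨ n.1.1 ≠ 0 ∨ (n.1.2 ≠ 1 ∧ q.fst = 1))) ∧
    ((p.fst = 0 ∨ p.fst = 1) ∨ m.1.2 ≠ 0 ∨ (m.1.1 ≠ 1 ∧ p.snd = 1)) ∧
      ((q.fst = 0 ∨ q.fst = 1) ∨ n.1.2 ≠ 0 ∨ (n.1.1 ≠ 1 ∧ q.snd = 1)) := by
  cases h <;>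
    simp [SquareBoundary.fst, SquareBoundary.snd, SquareBoundary.left,
      SquareBoundary.right, SquareBoundary.top, SquareBoundary.bottom]

/-- Points of opposite sides of `X` have distances that are bounded below by those in the
Sierpinski carpet, up to `ε`. -/
def WideUpTo (X : SquaMS.{u}) (ε : ℝ) : Prop :=
  ∀ r s : Set.Icc (0 : ℝ) 1, CrossLE ε r s (dist (X.S (.left r)) (X.S (.right s))) ∧
    CrossLE ε r s (dist (X.S (.bottom r)) (X.S (.top s)))

/-- `crossFun` is 0 at the starting point and `1 + height` on the opposite side. `height` loses `ε /
3`, and the remaining `ε / 6` allows for an infimum in `detour` that need not be attained. -/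
theorem crossLE_of_crossFun {ε r s d : ℝ} (hε : 0 < ε) {i j : Fin 3} {a b : ℝ} {i' j' : Fin 3}
    {a' b' : ℝ} (hi : ((i : ℕ) : ℝ) + a = 0) (ha : 0 ≤ a) (hj : ((j : ℕ) : ℝ) + b = 3 * r)
    (hi' : ((i' : ℕ) : ℝ) + a' = 3) (ha' : a' ≤ 1) (hj' : ((j' : ℕ) : ℝ) + b' = 3 * s)
    (h : |crossFun (ε / 3) r i j a b - crossFun (ε / 3) r i' j' a' b'| ≤ d) :
    CrossLE (ε / 2) r s d := by
  have hi0 : (0 : ℝ) ≤ ((i : ℕ) : ℝ) := Nat.cast_nonneg _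
  have hi1 : ((i : ℕ) : ℝ) = 0 := by linarith
  have hi2 : i = 0 := Fin.ext (Nat.cast_eq_zero.1 hi1)
  have ha0 : a = 0 := by linarith
  have hi3 : i' ≠ 0 := by
    rintro rfl
    simp only [Fin.val_zero, Nat.cast_zero] at hi'
    linarith
  have e1 : crossFun (ε / 3) r i j a b = 0 := by
    rw [crossFun, hi, hj, if_pos ⟨hi2, Or.inr (by rw [ha0]; exact zero_lt_one)⟩]
    simp
  have e2 : crossFun (ε / 3) r i' j' a' b' = 1 + height (ε / 3) r s := by
    rw [crossFun_eq (by positivity) (Or.inr (Or.inl hi3)), hi', hj']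
    congr 1
    · norm_num
    · congr 1; ring
  rw [e1, e2, zero_sub, abs_neg] at h
  have h1 := (le_abs_self _).trans h
  have h2 : detour r s - ε / 3 ≤ height (ε / 3) r s := le_max_left _ _
  obtain ⟨c, hc, h3⟩ := exists_lt_of_detour_lt (show detour r s < d - 1 + ε / 2 by linarith)
  exact ⟨c, hc, by linarith⟩

/-- The error improves because a crossing of `X` counts one third in `M ⊗ X` and `crossFun` invokes
the hypothesis in the first column only; the other two columns are estimated by the taxicab metric.
-/
theorem WideUpTo.tensor {ε : ℝ} (hε : 0 < ε) (h : WideUpTo X ε) : WideUpTo X.tensor (ε / 2) := by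
  have hε3 : 0 ≤ ε / 3 := by positivity
  intro r s
  constructor
  · have key := abs_sub_le_pathDist (X := X)
      (fun m p => crossFun (ε / 3) r m.1.1 m.1.2 p.fst p.snd)
      (fun m p => crossFun_mem hε3 r.2 _ _ p.fst_mem p.snd_mem)
      (fun m p q => abs_crossFun_sub_le hε.le _ _ p.fst_le q.fst_le p.2.2.2 q.2.2.2 (X.sq₂ p q)
        (fun h1 h2 => by
          rw [SquareBoundary.eq_left h1, SquareBoundary.eq_right h2]
          exact (h ⟨p.snd, p.snd_mem⟩ ⟨q.snd, q.snd_mem⟩).1)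
        (fun h1 h2 => by
          rw [SquareBoundary.eq_right h1, SquareBoundary.eq_left h2, dist_comm]
          exact (h ⟨q.snd, q.snd_mem⟩ ⟨p.snd, p.snd_mem⟩).1.symm))
      (fun m n p q hE => by
        obtain ⟨h1, h2⟩ := E_pos hE
        obtain ⟨⟨h3, h4⟩, -⟩ := E_side hE
        simp only at h1 h2 ⊢
        rw [crossFun_eq hε3 h3, crossFun_eq hε3 h4]
        unfold Idx.col at h1
        unfold Idx.row at h2
        rw [h1, h2])
      (cell (.left r)) (cell (.right s)) (rel (.left r)) (rel (.right s))
    refine crossLE_of_crossFun hε ?_ (SquareBoundary.fst_nonneg _) (cell_rel _).2 ?_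
      (SquareBoundary.fst_le _) (cell_rel _).2 key
    · exact (cell_rel _).1.trans (mul_zero 3)
    · exact (cell_rel _).1.trans (mul_one 3)
  -- The same argument with rows and columns interchanged.
  · have key := abs_sub_le_pathDist (X := X)
      (fun m p => crossFun (ε / 3) r m.1.2 m.1.1 p.snd p.fst)
      (fun m p => crossFun_mem hε3 r.2 _ _ p.snd_mem p.fst_mem)
      (fun m p q => abs_crossFun_sub_le hε.le _ _ p.snd_le q.snd_le p.2.2.2.symm q.2.2.2.symm
        ((add_comm _ _).trans_le (X.sq₂ p q))
        (fun h1 h2 => by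
          rw [SquareBoundary.eq_bottom h1, SquareBoundary.eq_top h2]
          exact (h ⟨p.fst, p.fst_mem⟩ ⟨q.fst, q.fst_mem⟩).2)
        (fun h1 h2 => by
          rw [SquareBoundary.eq_top h1, SquareBoundary.eq_bottom h2, dist_comm]
          exact (h ⟨q.fst, q.fst_mem⟩ ⟨p.fst, p.fst_mem⟩).2.symm))
      (fun m n p q hE => by
        obtain ⟨h1, h2⟩ := E_pos hE
        obtain ⟨-, h3, h4⟩ := E_side hE
        simp only at h1 h2 ⊢
        rw [crossFun_eq hε3 h3, crossFun_eq hε3 h4]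
        unfold Idx.col at h1
        unfold Idx.row at h2
        rw [h1, h2])
      (cell (.bottom r)) (cell (.top s)) (rel (.bottom r)) (rel (.top s))
    refine crossLE_of_crossFun hε ?_ (SquareBoundary.snd_nonneg _) (cell_rel _).1 ?_
      (SquareBoundary.snd_le _) (cell_rel _).1 key
    · exact (cell_rel _).2.trans (mul_zero 3)
    · exact (cell_rel _).2.trans (mul_one 3)

/-- The detour via 0 costs `r + s` and the one via 1 costs `2 - r - s`; the smaller is at most 1. -/
theorem wideUpTo_one (X : SquaMS.{u}) : WideUpTo X 1 := by
  have key : ∀ r s : Set.Icc (0 : ℝ) 1, ∀ d : ℝ, 1 + |(r : ℝ) - s| ≤ d → CrossLE 1 r s d := by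
    intro r s d hd
    obtain ⟨h1, h2⟩ := r.2
    obtain ⟨h3, h4⟩ := s.2
    have h5 := abs_nonneg ((r : ℝ) - s)
    rcases le_total ((r : ℝ) + s) 1 with h | h
    · refine ⟨0, .zero, ?_⟩
      rw [sub_zero, sub_zero, abs_of_nonneg h1, abs_of_nonneg h3]
      linarith
    · refine ⟨1, .one, ?_⟩
      rw [abs_of_nonpos (by linarith), abs_of_nonpos (by linarith)]
      linarith
  refine fun r s => ⟨key r s _ ?_, key r s _ ?_⟩
  · have := X.sq₂ (.left r) (.right s)
    simpa [SquareBoundary.left, SquareBoundary.right, SquareBoundary.fst, SquareBoundary.snd]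
      using this
  · have := X.sq₂ (.bottom r) (.top s)
    simpa [SquareBoundary.bottom, SquareBoundary.top, SquareBoundary.fst, SquareBoundary.snd,
      add_comm] using this

theorem dist_S_le_of_hom (f : X ⟶ Y) (p q : SquareBoundary) :
    dist (Y.S p) (Y.S q) ≤ dist (X.S p) (X.S q) := by
  rw [← Hom.map_S f, ← Hom.map_S f]; exact Hom.short f _ _

/-- A morphism `X ⟶ X.tensor` makes boundary distances in `X` at least those in `M ⊗ X`, so `X`
inherits the halved error. -/
theorem wideUpTo_of_coalgebra (β : X ⟶ X.tensor) (n : ℕ) : WideUpTo X ((1 / 2) ^ n) := by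
  induction n with
  | zero => simpa using wideUpTo_one X
  | succ n ih =>
    intro r s
    obtain ⟨⟨c, hc, h1⟩, c', hc', h2⟩ := ih.tensor (by positivity) r s
    have e : (1 / 2 : ℝ) ^ n / 2 = (1 / 2) ^ (n + 1) := by rw [pow_succ]; ring
    rw [e] at h1 h2
    exact ⟨⟨c, hc, h1.trans (by gcongr; exact dist_S_le_of_hom β _ _)⟩,
      c', hc', h2.trans (by gcongr; exact dist_S_le_of_hom β _ _)⟩

/-! ### Upper bounds for crossings in algebras, and the comparison -/

/-- In an algebra, there are straight lines through the carpet at the heights of Cantor end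
points. -/
theorem dist_cross_le_of_algebra (α : X.tensor ⟶ X) {c : ℝ} (hc : IsCantorEnd c)
    (hm : c ∈ Set.Icc (0 : ℝ) 1) :
    dist (X.S (.left ⟨c, hm⟩)) (X.S (.right ⟨c, hm⟩)) ≤ 1 ∧
      dist (X.S (.bottom ⟨c, hm⟩)) (X.S (.top ⟨c, hm⟩)) ≤ 1 := by
  -- Three consecutive cells, each crossed at cost at most 1/3.
  have chain : ∀ (k : Fin 3 → Idx) (p q p' q' : SquareBoundary),
      dist (X.S p) (X.S q) ≤ 1 →
      (tensorS X p' = tmk (k 0, X.S p)) → (tmk (k 0, X.S q) = tmk (k 1, X.S p)) →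
      (tmk (k 1, X.S q) = tmk (k 2, X.S p)) → (tensorS X q' = tmk (k 2, X.S q)) →
      dist (X.S p') (X.S q') ≤ 1 := by
    intro k p q p' q' h h1 h2 h3 h4
    refine (dist_S_le_of_hom α p' q').trans ?_
    change dist (tensorS X p') (tensorS X q') ≤ 1
    rw [h1, h4]
    have t1 := dist_triangle4 (tmk (k 0, X.S p)) (tmk (k 0, X.S q)) (tmk (k 1, X.S q))
      (tmk (k 2, X.S q))
    have t2 := dist_tmk_same (k 0) (X.S p) (X.S q)
    have t3 := dist_tmk_same (k 1) (X.S p) (X.S q)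
    have t4 := dist_tmk_same (k 2) (X.S p) (X.S q)
    rw [← h2] at t3
    rw [← h3] at t4
    linarith
  -- For `j ≠ 1` the row or column `j` avoids the hole, so all three cells are present.
  have step : ∀ (j : Fin 3) (hj : j ≠ 1) (c c' : Set.Icc (0 : ℝ) 1),
      (c' : ℝ) = (((j : ℕ) : ℝ) + c) / 3 →
      (dist (X.S (.left c)) (X.S (.right c)) ≤ 1 ∧ dist (X.S (.bottom c)) (X.S (.top c)) ≤ 1) →
      dist (X.S (.left c')) (X.S (.right c')) ≤ 1 ∧
        dist (X.S (.bottom c')) (X.S (.top c')) ≤ 1 := by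
    rintro j hj c c' hc' ⟨h1, h2⟩
    have hc3 : (((j : ℕ) : ℝ) + c) = 3 * (c' : ℝ) := by rw [hc']; ring
    refine ⟨chain (fun i => ⟨(i, j), fun h => hj (congrArg Prod.snd h)⟩) (.left c) (.right c)
      _ _ h1 (tensorS_eq ?_ hc3) (tmk_eq (glue_of_pos ?_ rfl)) (tmk_eq (glue_of_pos ?_ rfl))
      (tensorS_eq ?_ hc3),
      chain (fun i => ⟨(j, i), fun h => hj (congrArg Prod.fst h)⟩) (.bottom c) (.top c)
      _ _ h2 (tensorS_eq hc3 ?_) (tmk_eq (glue_of_pos rfl ?_)) (tmk_eq (glue_of_pos rfl ?_))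
      (tensorS_eq hc3 ?_)⟩ <;>
    simp [Idx.col, Idx.row, SquareBoundary.left, SquareBoundary.right, SquareBoundary.bottom,
      SquareBoundary.top, SquareBoundary.fst, SquareBoundary.snd] <;> norm_num
  induction hc with
  | zero =>
    exact ⟨((dist_S_of_snd_eq (Or.inl rfl) rfl rfl).trans (by
        simp [SquareBoundary.left, SquareBoundary.right, SquareBoundary.fst])).le,
      ((dist_S_of_fst_eq (Or.inl rfl) rfl rfl).trans (by
        simp [SquareBoundary.bottom, SquareBoundary.top, SquareBoundary.snd])).le⟩
  | one =>
    exact ⟨((dist_S_of_snd_eq (Or.inr rfl) rfl rfl).trans (by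
        simp [SquareBoundary.left, SquareBoundary.right, SquareBoundary.fst])).le,
      ((dist_S_of_fst_eq (Or.inr rfl) rfl rfl).trans (by
        simp [SquareBoundary.bottom, SquareBoundary.top, SquareBoundary.snd])).le⟩
  | low h ih => exact step 0 (by decide) ⟨_, h.mem⟩ _ (by simp) (ih _)
  | high h ih => exact step 2 (by decide) ⟨_, h.mem⟩ _ (by simp) (ih _)

/-- In `Y`, move along the first side to the Cantor end point supplied by `X`, cross at cost at most
1, and move along the opposite side. This is at most the distance in `X` plus `(1 / 2) ^ n`, for
every `n`. -/
theorem dist_opposite_le (α : Y.tensor ⟶ Y) (β : X ⟶ X.tensor) (r s : Set.Icc (0 : ℝ) 1) :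
    dist (Y.S (.left r)) (Y.S (.right s)) ≤ dist (X.S (.left r)) (X.S (.right s)) ∧
      dist (Y.S (.bottom r)) (Y.S (.top s)) ≤ dist (X.S (.bottom r)) (X.S (.top s)) := by
  have hlim : ∀ d e : ℝ, (∀ n : ℕ, d ≤ e + (1 / 2) ^ n) → d ≤ e := by
    intro d e h
    refine le_of_forall_pos_le_add fun ε hε => ?_
    obtain ⟨n, hn⟩ := exists_pow_lt_of_lt_one hε (by norm_num : (1 / 2 : ℝ) < 1)
    linarith [h n]
  refine ⟨hlim _ _ fun n => ?_, hlim _ _ fun n => ?_⟩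
  · obtain ⟨c, hc, h⟩ := (wideUpTo_of_coalgebra β n r s).1
    have h1 := (dist_cross_le_of_algebra α hc hc.mem).1
    have h2 := dist_triangle4 (Y.S (.left r)) (Y.S (.left ⟨c, hc.mem⟩))
      (Y.S (.right ⟨c, hc.mem⟩)) (Y.S (.right s))
    rw [Y.sq₁_left, Y.sq₁_right] at h2
    rw [abs_sub_comm (r : ℝ)] at h
    simp only at h2
    linarith
  · obtain ⟨c, hc, h⟩ := (wideUpTo_of_coalgebra β n r s).2
    have h1 := (dist_cross_le_of_algebra α hc hc.mem).2
    have h2 := dist_triangle4 (Y.S (.bottom r)) (Y.S (.bottom ⟨c, hc.mem⟩))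
      (Y.S (.top ⟨c, hc.mem⟩)) (Y.S (.top s))
    rw [Y.sq₁_bottom, Y.sq₁_top] at h2
    rw [abs_sub_comm (r : ℝ)] at h
    simp only at h2
    linarith

/-- Points on adjacent sides have the taxicab distance. -/
theorem dist_S_adjacent_le {p q : SquareBoundary} (hp : p.fst = 0 ∨ p.fst = 1)
    (hq : q.snd = 0 ∨ q.snd = 1) :
    dist (X.S p) (X.S q) ≤ |p.fst - q.fst| + |p.snd - q.snd| := by
  let k : SquareBoundary :=
    ⟨(p.fst, q.snd), p.fst_mem, q.snd_mem, Or.inl hp⟩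
  have h1 : dist (X.S p) (X.S k) = |k.snd - p.snd| := dist_S_of_fst_eq hp rfl rfl
  have h2 : dist (X.S k) (X.S q) = |q.fst - k.fst| := dist_S_of_snd_eq hq rfl rfl
  have h3 : k.fst = p.fst := rfl
  have h4 : k.snd = q.snd := rfl
  rw [h4] at h1
  rw [h3] at h2
  have := dist_triangle (X.S p) (X.S k) (X.S q)
  rw [abs_sub_comm p.fst, abs_sub_comm p.snd]
  linarith

/-- Distances on the boundary in an algebra are at most those in a coalgebra. -/
theorem dist_S_algebra_le_coalgebra (α : Y.tensor ⟶ Y) (β : X ⟶ X.tensor)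
    (p q : SquareBoundary) : dist (Y.S p) (Y.S q) ≤ dist (X.S p) (X.S q) := by
  have hopp := dist_opposite_le α β
  rcases p.2.2.2 with hp | hp <;> rcases q.2.2.2 with hq | hq
  · by_cases he : p.fst = q.fst
    · exact ((dist_S_of_fst_eq hp rfl he.symm).trans (dist_S_of_fst_eq hp rfl he.symm).symm).le
    · rcases hp with hp | hp <;> rcases hq with hq | hq
      · exact absurd (hp.trans hq.symm) he
      · rw [SquareBoundary.eq_left hp, SquareBoundary.eq_right hq]; exact (hopp _ _).1
      · rw [SquareBoundary.eq_right hp, SquareBoundary.eq_left hq, dist_comm,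
          dist_comm (X.S _)]
        exact (hopp _ _).1
      · exact absurd (hp.trans hq.symm) he
  · exact (dist_S_adjacent_le hp hq).trans (X.sq₂ p q)
  · rw [dist_comm, dist_comm (X.S p)]
    exact (dist_S_adjacent_le hq hp).trans (X.sq₂ q p)
  · by_cases he : p.snd = q.snd
    · exact ((dist_S_of_snd_eq hp rfl he.symm).trans (dist_S_of_snd_eq hp rfl he.symm).symm).le
    · rcases hp with hp | hp <;> rcases hq with hq | hq
      · exact absurd (hp.trans hq.symm) he
      · rw [SquareBoundary.eq_bottom hp, SquareBoundary.eq_top hq]; exact (hopp _ _).2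
      · rw [SquareBoundary.eq_top hp, SquareBoundary.eq_bottom hq, dist_comm,
          dist_comm (X.S _)]
        exact (hopp _ _).2
      · exact absurd (hp.trans hq.symm) he

/-! ### Maps that preserve the boundary -/

/-- Maps of square metric spaces that preserve the boundary. -/
structure BdMap (X Y : SquaMS.{u}) where
  toFun : X → Y
  map_S : ∀ p, toFun (X.S p) = Y.S p

instance : Nonempty (BdMap X Y) :=
  ⟨⟨Function.extend X.S Y.S fun _ => Y.S (.left ⟨0, by simp⟩),
    fun p => X.S_injective.extend_apply _ _ p⟩⟩

namespace BdMap

/-- The action of a boundary preserving map on `M ⊗ X`. -/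
def tensorMap (h : BdMap X Y) : Tensor X → Tensor Y :=
  Quotient.lift (fun a => tmk (a.1, h.toFun a.2)) fun _ _ hab =>
    respects (fun a : Idx × X => (tmk (a.1, h.toFun a.2) : Tensor Y)) (by
      rintro ⟨m, x⟩ ⟨n, y⟩ ⟨p, q, hE, hx, hy⟩
      simp only at hx hy hE ⊢
      rw [hx, hy, h.map_S, h.map_S]
      exact tmk_eq (.rel _ _ ⟨p, q, hE, rfl, rfl⟩)) hab

theorem tensorMap_S (h : BdMap X Y) (p : SquareBoundary) :
    h.tensorMap (X.tensor.S p) = Y.tensor.S p :=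
  congrArg (fun y => tmk (cell p, y)) (h.map_S (rel p))

theorem dist_tensorMap_le {h h' : BdMap X Y} {c : ℝ}
    (hc : ∀ x, dist (h.toFun x) (h'.toFun x) ≤ c) (t : Tensor X) :
    dist (h.tensorMap t) (h'.tensorMap t) ≤ c / 3 := by
  obtain ⟨m, x⟩ := t
  refine (dist_tmk_same m _ _).trans ?_
  linarith [hc x]

/-- Paths may have many steps, so errors must not be added along them. Instead the distance `u` from
the image of `m ⊗ x` is replaced by a truly short function `U` that agrees with `u` on the
boundaries of the cells. The error then enters only at the two ends of the path, with `ε / 3` each.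
-/
theorem tensorMap_almost_short (h : BdMap X Y) {ε : ℝ}
    (hS : ∀ p q, dist (Y.S p) (Y.S q) ≤ dist (X.S p) (X.S q))
    (hε : ∀ x y, dist (h.toFun x) (h.toFun y) ≤ dist x y + ε) (s t : Tensor X) :
    dist (h.tensorMap s) (h.tensorMap t) ≤ dist s t + 2 / 3 * ε := by
  obtain ⟨m, x⟩ := s
  obtain ⟨n, y⟩ := t
  have hε0 : 0 ≤ ε := by simpa using hε x x
  let u : Idx × X → ℝ := fun c => dist (tmk (m, h.toFun x)) (tmk (c.1, h.toFun c.2))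
  have hu0 : ∀ c, 0 ≤ u c := fun c => dist_nonneg
  have hu2 : ∀ c, u c ≤ 2 := fun c => Y.tensor.dist_le_two _ _
  have hu : ∀ k z w, u (k, w) ≤ u (k, z) + dist (h.toFun z) (h.toFun w) / 3 := fun k z w =>
    (dist_triangle _ (tmk (k, h.toFun z)) _).trans (add_le_add le_rfl (dist_tmk_same _ _ _))
  -- McShane extension of the boundary values of `u` to each copy. By `hS` these values are short
  -- for the metric of `X`, so `V` does extend them.
  let V : Idx × X → ℝ := fun c => ⨅ q, (u (c.1, X.S q) + dist (X.S q) c.2 / 3)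
  have : Nonempty SquareBoundary := ⟨.left ⟨0, by simp⟩⟩
  have hVle : ∀ k z q, V (k, z) ≤ u (k, X.S q) + dist (X.S q) z / 3 := fun k z q =>
    ciInf_le (f := fun q => u (k, X.S q) + dist (X.S q) z / 3)
      ⟨0, by rintro _ ⟨q, rfl⟩; have := hu0 (k, X.S q); positivity⟩ q
  have hV0 : ∀ c, 0 ≤ V c := fun c => le_ciInf fun q => by
    have := hu0 (c.1, X.S q); positivity
  have hVS : ∀ k p, V (k, X.S p) = u (k, X.S p) := by
    intro k p
    refine le_antisymm ((hVle k _ p).trans (by simp)) (le_ciInf fun q => ?_)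
    have h1 := hu k (X.S q) (X.S p)
    rw [h.map_S, h.map_S] at h1
    simp only
    linarith [hS q p]
  have hVu : ∀ k z, u (k, z) - ε / 3 ≤ V (k, z) := fun k z => le_ciInf fun q => by
    have h1 := hu k (X.S q) z
    have h2 := hε (X.S q) z
    simp only
    linarith
  have hVd : ∀ k z w, V (k, z) - V (k, w) ≤ dist z w / 3 := by
    intro k z w
    have : V (k, z) - dist z w / 3 ≤ V (k, w) := le_ciInf fun q => by
      have h1 := hVle k z q
      have h2 := dist_triangle (X.S q) w z
      rw [dist_comm w z] at h2
      simp only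
      linarith
    linarith
  -- `V` need not be small at the starting point, as it only sees ways through the boundary; `W`
  -- accounts for ways inside the copy `m`.
  let W : Idx × X → ℝ := fun c => if c.1 = m then dist x c.2 / 3 + ε / 3 else 2
  have hW0 : ∀ c, 0 ≤ W c := fun c => by
    simp only [W]; split_ifs <;> positivity
  have hWu : ∀ c, u c ≤ W c := by
    rintro ⟨k, z⟩
    simp only [W]
    split_ifs with hk
    · subst hk
      refine (dist_tmk_same k (h.toFun x) (h.toFun z)).trans ?_
      linarith [hε x z]
    · exact hu2 _
  have hWd : ∀ k z w, W (k, z) - W (k, w) ≤ dist z w / 3 := by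
    intro k z w
    simp only [W]
    split_ifs
    · have := dist_triangle x w z
      rw [dist_comm w z] at this
      linarith
    · rw [sub_self]; positivity
  let U : Idx × X → ℝ := fun c => min 2 (min (V c) (W c))
  have hUS : ∀ k p, U (k, X.S p) = u (k, X.S p) := fun k p => by
    simp only [U]
    rw [hVS, min_eq_left (hWu _), min_eq_right (hu2 _)]
  have hU : ∀ c, 0 ≤ U c ∧ U c ≤ 2 := fun c =>
    ⟨le_min zero_le_two (le_min (hV0 c) (hW0 c)), min_le_left _ _⟩
  have key := short_of_prodDist (X := X) U ?_ ?_ (m, x) (n, y)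
  · have h1 : U (m, x) ≤ ε / 3 := by
      refine (min_le_right _ _).trans ((min_le_right _ _).trans ?_)
      simp [W]
    have h2 : u (n, y) - ε / 3 ≤ U (n, y) :=
      le_min (by linarith [hu2 (n, y)]) (le_min (hVu n y) (by linarith [hWu (n, y)]))
    rw [dist_comm, Real.dist_eq] at key
    have h3 := (le_abs_self _).trans key
    change u (n, y) ≤ pathDist X (m, x) (n, y) + 2 / 3 * ε
    linarith
  · rintro ⟨k, z⟩ ⟨l, w⟩ ⟨p, q, hE, hz, hw⟩
    simp only at hz hw hE
    subst hz hw
    rw [hUS, hUS]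
    simp only [u, h.map_S]
    rw [tmk_eq (.rel (k, Y.S p) (l, Y.S q) ⟨p, q, hE, rfl, rfl⟩)]
  · rintro ⟨k, z⟩ ⟨l, w⟩
    unfold prodDist
    rw [Real.dist_eq]
    split_ifs with hk
    · simp only at hk ⊢
      subst hk
      refine (abs_min_sub_min_le_max _ _ _ _).trans (max_le ?_ ?_)
      · rw [sub_self, abs_zero]; positivity
      refine (abs_min_sub_min_le_max _ _ _ _).trans (max_le ?_ ?_)
      · have h1 := hVd k w z
        rw [dist_comm] at h1
        exact abs_le.2 ⟨by linarith, hVd k z w⟩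
      · have h1 := hWd k w z
        rw [dist_comm] at h1
        exact abs_le.2 ⟨by linarith, hWd k z w⟩
    · have h1 := hU (k, z)
      have h2 := hU (l, w)
      exact abs_le.2 ⟨by linarith [h1.1, h2.2], by linarith [h1.2, h2.1]⟩

/-- The map `α ∘ (M ⊗ h) ∘ β`. -/
def iter (β : X ⟶ X.tensor) (α : Y.tensor ⟶ Y) (h : BdMap X Y) : BdMap X Y where
  toFun x := Hom.toFun α (h.tensorMap (Hom.toFun β x))
  map_S p := by rw [Hom.map_S β, tensorMap_S, Hom.map_S α]

theorem dist_iter_le (β : X ⟶ X.tensor) (α : Y.tensor ⟶ Y) {h h' : BdMap X Y} {c : ℝ}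
    (hc : ∀ x, dist (h.toFun x) (h'.toFun x) ≤ c) (x : X) :
    dist ((iter β α h).toFun x) ((iter β α h').toFun x) ≤ c / 3 :=
  (Hom.short α _ _).trans (dist_tensorMap_le hc _)

theorem iter_almost_short (β : X ⟶ X.tensor) (α : Y.tensor ⟶ Y) (h : BdMap X Y) {ε : ℝ}
    (hε : ∀ x y, dist (h.toFun x) (h.toFun y) ≤ dist x y + ε) (x y : X) :
    dist ((iter β α h).toFun x) ((iter β α h).toFun y) ≤ dist x y + 2 / 3 * ε :=
  ((Hom.short α _ _).trans
    (tensorMap_almost_short h (dist_S_algebra_le_coalgebra α β) hε _ _)).trans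
    (add_le_add (Hom.short β x y) le_rfl)

theorem dist_iterate_le (β : X ⟶ X.tensor) (α : Y.tensor ⟶ Y) (h h' : BdMap X Y) (n : ℕ) (x : X) :
    dist (((iter β α)^[n] h).toFun x) (((iter β α)^[n] h').toFun x) ≤ 2 * (1 / 3) ^ n := by
  induction n generalizing x with
  | zero => simpa using Y.dist_le_two _ _
  | succ n ih =>
    rw [Function.iterate_succ_apply', Function.iterate_succ_apply']
    refine (dist_iter_le β α ih x).trans (le_of_eq ?_)
    rw [pow_succ]; ring

/-- The initial error 2 is the bound on all distances. -/
theorem iterate_almost_short (β : X ⟶ X.tensor) (α : Y.tensor ⟶ Y) (h : BdMap X Y) (n : ℕ)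
    (x y : X) : dist (((iter β α)^[n] h).toFun x) (((iter β α)^[n] h).toFun y) ≤
      dist x y + 2 * (2 / 3) ^ n := by
  induction n generalizing x y with
  | zero =>
    have := Y.dist_le_two (h.toFun x) (h.toFun y)
    simp only [Function.iterate_zero, id_eq, pow_zero, mul_one]
    linarith [dist_nonneg (x := x) (y := y)]
  | succ n ih =>
    rw [Function.iterate_succ_apply']
    refine (iter_almost_short β α _ ih x y).trans (le_of_eq ?_)
    rw [pow_succ]; ring

end BdMap

/-! ### Morphisms from coalgebras to complete algebras -/

/-- There is a morphism from a coalgebra to a complete algebra. -/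
theorem exists_hom_of_complete [CompleteSpace Y] (β : X ⟶ tensorFunctor.obj X)
    (α : tensorFunctor.obj Y ⟶ Y) : ∃ h : X ⟶ Y, β ≫ tensorFunctor.map h ≫ α = h := by
  -- The starting map need not even be continuous.
  obtain ⟨h₀⟩ : Nonempty (BdMap X Y) := inferInstance
  let f : ℕ → BdMap X Y := fun n => (BdMap.iter β α)^[n] h₀
  have hf : ∀ x n, dist ((f n).toFun x) ((f (n + 1)).toFun x) ≤ 2 * (1 / 3 : ℝ) ^ n :=
    fun x n => BdMap.dist_iterate_le β α h₀ (BdMap.iter β α h₀) n x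
  have hr : (1 / 3 : ℝ) < 1 := by norm_num
  have hlim : ∀ x, ∃ y, Filter.Tendsto (fun n => (f n).toFun x) Filter.atTop (nhds y) := fun x =>
    cauchySeq_tendsto_of_complete (cauchySeq_of_le_geometric _ _ hr (hf x))
  choose l hl using hlim
  have hd : ∀ n x, dist ((f n).toFun x) (l x) ≤ 2 * (1 / 3 : ℝ) ^ n / (1 - 1 / 3) := fun n x =>
    dist_le_of_le_geometric_of_tendsto _ _ hr (hf x) (hl x) n
  let lS : BdMap X Y := ⟨l, fun p => tendsto_nhds_unique (hl _) (by
    simp only [(f _).map_S]; exact tendsto_const_nhds)⟩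
  let h : X ⟶ Y :=
    { toFun := l
      short := by
        intro x y
        have h1 : Filter.Tendsto (fun n : ℕ => dist x y + 2 * (2 / 3 : ℝ) ^ n) Filter.atTop
            (nhds (dist x y)) := by
          have := (tendsto_pow_atTop_nhds_zero_of_lt_one (by norm_num : (0 : ℝ) ≤ 2 / 3)
            (by norm_num)).const_mul 2
          simpa using this.const_add (dist x y)
        exact le_of_tendsto_of_tendsto' ((hl x).dist (hl y)) h1 fun n =>
          BdMap.iterate_almost_short β α h₀ n x y
      map_S := lS.map_S }
  refine ⟨h, ?_⟩
  apply Hom.ext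
  funext x
  change (BdMap.iter β α lS).toFun x = l x
  refine tendsto_nhds_unique ?_ ((hl x).comp (Filter.tendsto_add_atTop_nat 1))
  rw [tendsto_iff_dist_tendsto_zero]
  -- The geometric tail in `hd` is `3 * (1 / 3) ^ n`, and one more application of the operator
  -- divides it by 3.
  refine squeeze_zero (fun _ => dist_nonneg) (g := fun n : ℕ => (1 / 3 : ℝ) ^ n) (fun n => ?_)
    (tendsto_pow_atTop_nhds_zero_of_lt_one (by norm_num) hr)
  have h1 := BdMap.dist_iter_le β α (h := f n) (h' := lS) (hd n) x
  have h2 : f (n + 1) = BdMap.iter β α (f n) := Function.iterate_succ_apply' _ _ _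
  simp only [Function.comp_apply]
  rw [h2]
  refine h1.trans (le_of_eq ?_)
  ring

/-- There is at most one morphism from a coalgebra to an algebra. -/
theorem hom_unique_of_coalgebra (β : X ⟶ tensorFunctor.obj X) (α : tensorFunctor.obj Y ⟶ Y)
    {h h' : X ⟶ Y} (hh : β ≫ tensorFunctor.map h ≫ α = h)
    (hh' : β ≫ tensorFunctor.map h' ≫ α = h') : h = h' := by
  let toBd : (X ⟶ Y) → BdMap X Y := fun g => ⟨Hom.toFun g, Hom.map_S g⟩
  have hfix : ∀ g : X ⟶ Y, β ≫ tensorFunctor.map g ≫ α = g → ∀ n,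
      (BdMap.iter β α)^[n] (toBd g) = toBd g := by
    intro g hg n
    refine Function.iterate_fixed ?_ n
    exact congrArg toBd hg
  apply Hom.ext
  funext x
  -- Both maps are fixed by every iterate, so their distance is at most `2 * (1 / 3) ^ n` for all
  -- `n`.
  refine dist_le_zero.1 (ge_of_tendsto' (x := Filter.atTop)
    (f := fun n : ℕ => 2 * (1 / 3 : ℝ) ^ n) ?_ fun n => ?_)
  · simpa using (tendsto_pow_atTop_nhds_zero_of_lt_one (by norm_num : (0 : ℝ) ≤ 1 / 3)
      (by norm_num)).const_mul 2
  · have := BdMap.dist_iterate_le β α (toBd h) (toBd h') n x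
    rwa [hfix h hh, hfix h' hh'] at this

/-- A complete square metric space that is a fixed point of `M ⊗ -` is a final coalgebra. -/
theorem nonempty_isTerminal_of_complete (Q : Endofunctor.Coalgebra tensorFunctor.{u})
    [CompleteSpace Q.V] [IsIso Q.str] : Nonempty (Limits.IsTerminal Q) := by
  have h1 : ∀ B : Endofunctor.Coalgebra tensorFunctor.{u}, ∃ h : B.V ⟶ Q.V,
      B.str ≫ tensorFunctor.map h ≫ inv Q.str = h := fun B =>
    exists_hom_of_complete B.str (inv Q.str)
  choose h hh using h1
  refine ⟨Limits.IsTerminal.ofUniqueHom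
    (fun B => ⟨h B, by rw [← IsIso.comp_inv_eq, Category.assoc, hh]⟩) fun B g => ?_⟩
  apply Endofunctor.Coalgebra.Hom.ext
  refine hom_unique_of_coalgebra B.str (inv Q.str) ?_ (hh B)
  rw [← Category.assoc, IsIso.comp_inv_eq]
  exact g.h

end SquaMS

end

theorem mainTheorem2 :
    (∃ A : Endofunctor.Algebra SquaMS.tensorFunctor.{u}, Nonempty (Limits.IsInitial A)) ∧
    ∀ A : Endofunctor.Algebra SquaMS.tensorFunctor.{u}, Nonempty (Limits.IsInitial A) →
      ∃ (_ : IsIso A.str) (_ : IsIso (SquaMS.comparison A.a)),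
        Nonempty (Limits.IsTerminal
          (⟨SquaMS.completionFunctor.obj A.a,
            SquaMS.completionFunctor.map (inv A.str) ≫ inv (SquaMS.comparison A.a)⟩ :
              Endofunctor.Coalgebra SquaMS.tensorFunctor.{u})) := by
  refine ⟨⟨_, ⟨SquaMS.termAlgebraIsInitial⟩⟩, fun A ⟨hA⟩ => ?_⟩
  have h1 : IsIso A.str := Endofunctor.Algebra.Initial.str_isIso hA
  have h2 := SquaMS.isIso_comparison A.a
  refine ⟨h1, h2, ?_⟩
  let Q : Endofunctor.Coalgebra SquaMS.tensorFunctor.{u} :=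
    ⟨SquaMS.completionFunctor.obj A.a,
      SquaMS.completionFunctor.map (inv A.str) ≫ inv (SquaMS.comparison A.a)⟩
  have : CompleteSpace Q.V := inferInstanceAs (CompleteSpace (Completion A.a))
  have : IsIso Q.str := inferInstanceAs (IsIso (_ ≫ _))
  exact SquaMS.nonempty_isTerminal_of_complete Q
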